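/- A \emph{double chain} of $N=2n$ points is a set $D=U\cup L$ of $2n$ points in the plane, where $U$ and $L$ are disjoint, $|U|=|L|=n$, and the following holds. (i) The line through any two distinct points of $U$ is not vertical and leaves all the points of $L$ strictly below it, and the line through any two distinct points of $L$ is not vertical and leaves all the points of $U$ strictly above it. (ii) $U$ and $L$ are convex chains that bulge towards each other: among any three points of $U$ with increasing abscissas the middle one lies strictly below the line through the other two, and among any three points of $L$ with increasing abscissas the middle one lies strictly above the line through the other two. A \emph{non-crossing path partition} (ncp partition) of a finite set $S$ of points in the plane is a graph with vertex set $S$ which is non-crossing when its edges are drawn as straight segments and in which each connected component is a path; a single vertex counts as a path (of length $0$). It is an \emph{ncpws partition} (non-crossing path partition without singletons) if, in addition, every point of $S$ belongs to a path of length at least $1$. \textbf{Theorem.} A double chain of $N=2n$ points admits at least $\Omega(7.164102920^N)$ ncp partitions and at least $\Omega(6.164492582^N)$ ncpws partitions. That is, there are absolute constants $c_1,c_2>0$ and $n_0$ such that, for every $n\ge n_0$ and every double chain $D$ of $N=2n$ points, the number of ncp partitions of $D$ is at least $c_1\cdot 7.164102920^{N}$ and the number of ncpws partitions of $D$ is at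 least $c_2\cdot 6.164492582^{N}$. -/

import Mathlib

/-- The line through the two points `p` and `q` of the plane is not vertical, and it leaves the
point `r` strictly below. -/
def LeavesBelow (p q r : ℝ × ℝ) : Prop :=
  p.1 ≠ q.1 ∧ r.2 < p.2 + (q.2 - p.2) / (q.1 - p.1) * (r.1 - p.1)

/-- The line through the two points `p` and `q` of the plane is not vertical, and it leaves the
point `r` strictly above. -/
def LeavesAbove (p q r : ℝ × ℝ) : Prop :=
  p.1 ≠ q.1 ∧ p.2 + (q.2 - p.2) / (q.1 - p.1) * (r.1 - p.1) < r.2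

/-- `U` and `L` are the upper and the lower chain of a double chain of `2 * n` points.
The chains bulge towards each other: `U` lies on the graph of a strictly convex function,
`L` on the graph of a strictly concave one. -/
structure AreChains (n : ℕ) (U L : Finset (ℝ × ℝ)) : Prop where
  card_upper : U.card = n
  card_lower : L.card = n
  disjoint : Disjoint U L
  /-- among three points of `U`, the middle one is below the line through the other two -/
  upper_convex : ∀ p ∈ U, ∀ q ∈ U, ∀ r ∈ U, p.1 < q.1 → q.1 < r.1 → LeavesBelow p r q
  /-- among three points of `L`, the middle one is above the line through the other two -/
  lower_concave : ∀ p ∈ L, ∀ q ∈ L, ∀ r ∈ L, p.1 < q.1 → q.1 < r.1 → LeavesAbove p r q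
  /-- every line through two points of `U` leaves all the points of `L` below -/
  lower_below : ∀ p ∈ U, ∀ q ∈ U, p ≠ q → ∀ r ∈ L, LeavesBelow p q r
  /-- every line through two points of `L` leaves all the points of `U` above -/
  upper_above : ∀ p ∈ L, ∀ q ∈ L, p ≠ q → ∀ r ∈ U, LeavesAbove p q r

/-- `D` is a double chain of `2 * n` points in the plane. -/
def IsDoubleChain (n : ℕ) (D : Finset (ℝ × ℝ)) : Prop :=
  ∃ U L : Finset (ℝ × ℝ), AreChains n U L ∧ (D : Set (ℝ × ℝ)) = ↑U ∪ ↑L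

/-- The graph `G` on the finite point set `S`, drawn with straight edges, is non-crossing: no edge
passes through a point of `S` other than its endpoints, and two different edges have no point in
common, except possibly a common endpoint. -/
structure IsNonCrossing {S : Finset (ℝ × ℝ)} (G : SimpleGraph S) : Prop where
  vertex_edge : ∀ a b v : S, G.Adj a b → (v : ℝ × ℝ) ∉ openSegment ℝ (a : ℝ × ℝ) b
  edge_edge : ∀ a b c d : S, G.Adj a b → G.Adj c d → s(a, b) ≠ s(c, d) →
    Disjoint (openSegment ℝ (a : ℝ × ℝ) b) (openSegment ℝ (c : ℝ × ℝ) d)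

/-- `G` is a non-crossing path partition of `S`: it is non-crossing, and each of its connected
components is a path (possibly a single vertex). -/
structure IsNCP {S : Finset (ℝ × ℝ)} (G : SimpleGraph S) : Prop where
  nonCrossing : IsNonCrossing G
  component_path : ∀ C : G.ConnectedComponent,
    ∃ k : ℕ, Nonempty (C.toSimpleGraph ≃g SimpleGraph.pathGraph k)

/-- `G` is a non-crossing path partition of `S` without singletons: every point of `S` belongs to
a path with at least one edge. -/
structure IsNCPWS {S : Finset (ℝ × ℝ)} (G : SimpleGraph S) : Prop extends IsNCP G where
  no_singleton : ∀ v : S, ∃ w : S, G.Adj v w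

/-- The number of non-crossing path partitions of `S`. -/
noncomputable def numNCP (S : Finset (ℝ × ℝ)) : ℕ :=
  {G : SimpleGraph S | IsNCP G}.ncard

/-- The number of non-crossing path partitions of `S` without singletons. -/
noncomputable def numNCPWS (S : Finset (ℝ × ℝ)) : ℕ :=
  {G : SimpleGraph S | IsNCPWS G}.ncard

/-! Because the chains bulge towards each other, the interior of a chord of one chain avoids the
chords of the other chain and all segments between the chains; and two segments between the chains
are disjoint if their ends come in the same strict order on both chains (`disjoint_cross_cross`). So
one may choose a non-crossing family of paths on each chain independently, mark one end of some of
these paths, and join the i-th marked point above to the i-th marked point below. The result is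
always an ncp partition (`isOrderNCP_join`). Only paths with at most four vertices on a chain are
used.

The families on one chain are built by a scan from left to right with a stack: a new point is
pushed, or it forms a path with points from the top of the stack. From height h there is one way to
height h + 1, and there are 2, 3, 9, 24 ways to heights h, h - 1, h - 2, h - 3. The last step can be
read off from the result (`step_injective`), so distinct scans give distinct families. Explicit
integer weights on the heights 0, ..., 9 show that the number of families grows at least like
(36/5)^n. Forbidding unmarked single points turns the 2 into a 1 and the rate into 31/5.

A family on n points has between 0 and n marks. Hence F families yield at least F²/(n + 1) pairs
with equally many marks, and such a pair can be recovered from its joined graph (`join_injective`).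
The count is at least a constant times (36/5)^(2n)/(n + 1), respectively (31/5)^(2n)/(n + 1). As
36/5 and 31/5 exceed the claimed bases, the linear factor is absorbed. -/

/-! ### Recognising path components by integer coordinates. -/

/-- A walk changes the coordinate by one in each step, so it attains all intermediate values. -/
theorem exists_reachable_coord_eq {V : Type*} (G : SimpleGraph V) (d : V → ℤ)
    (step : ∀ x y, G.Adj x y → |d x - d y| = 1) {x y : V} (p : G.Walk x y) (j : ℤ)
    (hx : d x ≤ j) (hy : j ≤ d y) : ∃ z, G.Reachable x z ∧ d z = j := by
  induction p with
  | nil => exact ⟨_, SimpleGraph.Reachable.refl _, le_antisymm hx hy⟩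
  | @cons u v w h p ih =>
    by_cases hj : d u = j
    · exact ⟨u, SimpleGraph.Reachable.refl _, hj⟩
    · have h1 := step u v h
      have h2 := abs_le.1 h1.le
      obtain ⟨z, hz, hzj⟩ := ih (by omega) hy
      exact ⟨z, h.reachable.trans hz, hzj⟩

/-- An induced subgraph of a disjoint union of two-way infinite paths has only paths as its
connected components. -/
theorem component_iso_pathGraph {V K : Type*} [Finite V] (G : SimpleGraph V) (κ : V → K)
    (d : V → ℤ) (inj : ∀ x y, κ x = κ y → d x = d y → x = y)
    (adj : ∀ x y, G.Adj x y ↔ κ x = κ y ∧ |d x - d y| = 1) (C : G.ConnectedComponent) :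
    ∃ k : ℕ, Nonempty (C.toSimpleGraph ≃g SimpleGraph.pathGraph k) := by
  have step : ∀ x y, G.Adj x y → |d x - d y| = 1 := fun x y h => ((adj x y).1 h).2
  have hκ : ∀ x y, G.Reachable x y → κ x = κ y := by
    rintro x y ⟨p⟩
    induction p with
    | nil => rfl
    | cons h p ih => exact ((adj _ _).1 h).1.trans ih
  have hreach : ∀ x y : C.supp, G.Reachable (x : V) y := fun x y =>
    SimpleGraph.ConnectedComponent.exact (x.2.trans y.2.symm)
  obtain ⟨c, hc⟩ := C.nonempty_supp
  have : Nonempty C.supp := ⟨⟨c, hc⟩⟩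
  obtain ⟨x₀, h₀⟩ := Finite.exists_min (fun x : C.supp => d x)
  obtain ⟨x₁, h₁⟩ := Finite.exists_max (fun x : C.supp => d x)
  set k : ℕ := (d x₁ - d x₀ + 1).toNat with hk
  have hlt : ∀ x : C.supp, (d x - d x₀).toNat < k := fun x => by
    have := h₀ x
    have := h₁ x
    omega
  let f : C.supp → Fin k := fun x => ⟨(d x - d x₀).toNat, hlt x⟩
  -- On a component `κ` is constant, so `d` is injective there; by the discrete intermediate value
  -- property its range is an interval, shifted here to start at 0.
  have hf : Function.Bijective f := by
    constructor
    · intro x y hxy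
      have h2 : (d x - d x₀).toNat = (d y - d x₀).toNat := congrArg Fin.val hxy
      have := h₀ x
      have := h₀ y
      exact Subtype.ext (inj x y (hκ _ _ (hreach x y)) (by omega))
    · rintro ⟨i, hi⟩
      obtain ⟨p⟩ := hreach x₀ x₁
      obtain ⟨z, hz, hzi⟩ := exists_reachable_coord_eq G d step p (d x₀ + i) (by omega) (by omega)
      refine ⟨⟨z, ?_⟩, ?_⟩
      · exact (SimpleGraph.ConnectedComponent.sound hz.symm).trans x₀.2
      · apply Fin.ext
        simp only [f]
        omega
  refine ⟨k, ⟨⟨Equiv.ofBijective f hf, ?_⟩⟩⟩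
  intro x y
  rw [SimpleGraph.pathGraph_adj]
  change ((d x - d x₀).toNat + 1 = (d y - d x₀).toNat ∨ (d y - d x₀).toNat + 1 =
    (d x - d x₀).toNat) ↔ G.Adj x y
  rw [adj, and_iff_right (hκ _ _ (hreach x y))]
  have := h₀ x
  have := h₀ y
  rw [abs_eq (by norm_num)]
  omega

/-! ### Geometry of the double chain: which segments are disjoint. -/

/-- Twice the signed area of the triangle `p q r`. -/
def orient (p q r : ℝ × ℝ) : ℝ := (q.1 - p.1) * (r.2 - p.2) - (q.2 - p.2) * (r.1 - p.1)

theorem LeavesBelow.orient_neg {p q r : ℝ × ℝ} (h : LeavesBelow p q r) (hpq : p.1 < q.1) :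
    orient p q r < 0 := by
  have h1 : 0 < q.1 - p.1 := sub_pos.2 hpq
  have h2 := h.2
  have h3 : (q.2 - p.2) / (q.1 - p.1) * (r.1 - p.1) * (q.1 - p.1)
      = (q.2 - p.2) * (r.1 - p.1) := by field_simp
  unfold orient
  nlinarith

theorem LeavesAbove.orient_pos {p q r : ℝ × ℝ} (h : LeavesAbove p q r) (hpq : p.1 < q.1) :
    0 < orient p q r := by
  have h1 : 0 < q.1 - p.1 := sub_pos.2 hpq
  have h2 := h.2
  have h3 : (q.2 - p.2) / (q.1 - p.1) * (r.1 - p.1) * (q.1 - p.1)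
      = (q.2 - p.2) * (r.1 - p.1) := by field_simp
  unfold orient
  nlinarith

/-- The points `X i` form a chain, enumerated from left to right, that bulges towards the
points `Y j`, which are below all its chords if `σ = 1` and above them if `σ = -1`. -/
structure IsBulgingChain {n : ℕ} (σ : ℝ) (X Y : Fin n → ℝ × ℝ) : Prop where
  mono : ∀ i j, i < j → (X i).1 < (X j).1
  middle : ∀ i j k, i < j → j < k → σ * orient (X i) (X k) (X j) < 0
  opposite : ∀ i j k, i < j → σ * orient (X i) (X j) (Y k) < 0

/-- Segments on different sides of a line are disjoint. -/
theorem disjoint_openSegment_of_affine {a b c d : ℝ × ℝ} (α β γ : ℝ)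
    (ha : 0 ≤ α * a.1 + β * a.2 + γ) (hb : 0 ≤ α * b.1 + β * b.2 + γ)
    (hc : α * c.1 + β * c.2 + γ ≤ 0) (hd : α * d.1 + β * d.2 + γ ≤ 0)
    (h : α * a.1 + β * a.2 + γ ≠ 0 ∨ α * b.1 + β * b.2 + γ ≠ 0 ∨
      α * c.1 + β * c.2 + γ ≠ 0 ∨ α * d.1 + β * d.2 + γ ≠ 0) :
    Disjoint (openSegment ℝ a b) (openSegment ℝ c d) := by
  rw [Set.disjoint_left]
  rintro _ ⟨s, t, hs, ht, hst, rfl⟩ ⟨s', t', hs', ht', hst', heq⟩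
  have e1 := congrArg Prod.fst heq
  have e2 := congrArg Prod.snd heq
  simp only [Prod.fst_add, Prod.smul_fst, Prod.snd_add, Prod.smul_snd, smul_eq_mul] at e1 e2
  have key : s * (α * a.1 + β * a.2 + γ) + t * (α * b.1 + β * b.2 + γ)
      = s' * (α * c.1 + β * c.2 + γ) + t' * (α * d.1 + β * d.2 + γ) := by
    linear_combination (-α) * e1 - β * e2 + γ * hst - γ * hst'
  generalize α * a.1 + β * a.2 + γ = fa at *
  generalize α * b.1 + β * b.2 + γ = fb at *
  generalize α * c.1 + β * c.2 + γ = fc at *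
  generalize α * d.1 + β * d.2 + γ = fd at *
  have h1 := mul_nonneg hs.le ha
  have h2 := mul_nonneg ht.le hb
  have h3 := mul_nonpos_of_nonneg_of_nonpos hs'.le hc
  have h4 := mul_nonpos_of_nonneg_of_nonpos ht'.le hd
  rcases h with h | h | h | h
  · exact h ((mul_eq_zero.1 (by linarith : s * fa = 0)).resolve_left hs.ne')
  · exact h ((mul_eq_zero.1 (by linarith : t * fb = 0)).resolve_left ht.ne')
  · exact h ((mul_eq_zero.1 (by linarith : s' * fc = 0)).resolve_left hs'.ne')
  · exact h ((mul_eq_zero.1 (by linarith : t' * fd = 0)).resolve_left ht'.ne')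

/-- Segments on different sides of the line through `p` and `q` are disjoint. -/
theorem disjoint_openSegment_of_orient {a b c d : ℝ × ℝ} (σ : ℝ) (p q : ℝ × ℝ)
    (ha : 0 ≤ σ * orient p q a) (hb : 0 ≤ σ * orient p q b)
    (hc : σ * orient p q c ≤ 0) (hd : σ * orient p q d ≤ 0)
    (h : σ * orient p q a ≠ 0 ∨ σ * orient p q b ≠ 0 ∨
      σ * orient p q c ≠ 0 ∨ σ * orient p q d ≠ 0) :
    Disjoint (openSegment ℝ a b) (openSegment ℝ c d) := by
  have e : ∀ r : ℝ × ℝ, σ * orient p q r = (-σ * (q.2 - p.2)) * r.1 + (σ * (q.1 - p.1)) * r.2 +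
      σ * ((q.2 - p.2) * p.1 - (q.1 - p.1) * p.2) := fun r => by unfold orient; ring
  simp only [e] at *
  exact disjoint_openSegment_of_affine _ _ _ ha hb hc hd h

theorem orient_left (p q : ℝ × ℝ) : orient p q p = 0 := by unfold orient; ring

theorem orient_right (p q : ℝ × ℝ) : orient p q q = 0 := by unfold orient; ring

theorem orient_swap (p q r : ℝ × ℝ) : orient p r q = -orient p q r := by unfold orient; ring

theorem orient_rotate (p q r : ℝ × ℝ) : orient q r p = orient p q r := by unfold orient; ring

theorem disjoint_openSegment_of_fst {a b c d : ℝ × ℝ} (hab : a.1 < b.1) (hbc : b.1 ≤ c.1)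
    (hcd : c.1 < d.1) : Disjoint (openSegment ℝ a b) (openSegment ℝ c d) := by
  refine disjoint_openSegment_of_affine (-1) 0 c.1 ?_ ?_ ?_ ?_
    (Or.inr (Or.inr (Or.inr (ne_of_lt ?_))))
  all_goals linarith

namespace IsBulgingChain

variable {n : ℕ} {σ : ℝ} {X Y : Fin n → ℝ × ℝ}

theorem monotone (h : IsBulgingChain σ X Y) {i j : Fin n} (hij : i ≤ j) :
    (X i).1 ≤ (X j).1 := by
  rcases hij.eq_or_lt with rfl | hij
  · exact le_rfl
  · exact (h.mono _ _ hij).le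

theorem injective (h : IsBulgingChain σ X Y) : Function.Injective X := by
  intro i j hij
  by_contra hne
  rcases lt_or_gt_of_ne hne with hlt | hlt
  · exact absurd (congrArg Prod.fst hij) (h.mono _ _ hlt).ne
  · exact absurd (congrArg Prod.fst hij) (h.mono _ _ hlt).ne'

theorem middle_nonpos (h : IsBulgingChain σ X Y) {i j k : Fin n} (hij : i ≤ j) (hjk : j ≤ k) :
    σ * orient (X i) (X k) (X j) ≤ 0 := by
  rcases hij.eq_or_lt with rfl | hij
  · simp [orient_left]
  rcases hjk.eq_or_lt with rfl | hjk
  · simp [orient_right]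
  exact (h.middle _ _ _ hij hjk).le

theorem orient_pos_after (h : IsBulgingChain σ X Y) {i j k : Fin n} (hij : i < j) (hjk : j < k) :
    0 < σ * orient (X i) (X j) (X k) := by
  have := h.middle i j k hij hjk
  rw [orient_swap] at this
  linarith

theorem orient_pos_before (h : IsBulgingChain σ X Y) {i j k : Fin n} (hij : i < j)
    (hjk : j < k) : 0 < σ * orient (X j) (X k) (X i) := by
  rw [orient_rotate]
  exact h.orient_pos_after hij hjk

/-- The line through the outer chord separates: the inner ends lie on it or on the side of the
opposite chain, and strictly so for at least one of them unless the chords coincide. -/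
theorem disjoint_nested (h : IsBulgingChain σ X Y) {a b c d : Fin n} (hac : a ≤ c) (hcd : c < d)
    (hdb : d ≤ b) (hne : ¬(a = c ∧ b = d)) :
    Disjoint (openSegment ℝ (X a) (X b)) (openSegment ℝ (X c) (X d)) := by
  refine disjoint_openSegment_of_orient σ (X a) (X b) ?_ ?_ ?_ ?_ ?_
  · simp [orient_left]
  · simp [orient_right]
  · exact h.middle_nonpos hac (hcd.le.trans hdb)
  · exact h.middle_nonpos (hac.trans hcd.le) hdb
  · rcases hac.eq_or_lt with rfl | hac
    · have : d < b := lt_of_le_of_ne hdb fun e => hne ⟨rfl, e.symm⟩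
      exact Or.inr (Or.inr (Or.inr (h.middle _ _ _ hcd this).ne))
    · exact Or.inr (Or.inr (Or.inl (h.middle _ _ _ hac (hcd.trans_le hdb)).ne))

/-- Two chords of a chain are separated by a vertical line, nested, or interleaved, and `nc`
excludes the last case. -/
theorem disjoint_chords (h : IsBulgingChain σ X Y) {R : Fin n → Fin n → Prop}
    (symm : ∀ a b, R a b → R b a)
    (nc : ∀ a b c d, R a b → R c d → a < c → c < b → b < d → False) {a b c d : Fin n}
    (hab : R a b) (hcd : R c d) (ab : a ≠ b) (cd : c ≠ d) (hne : s(a, b) ≠ s(c, d)) :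
    Disjoint (openSegment ℝ (X a) (X b)) (openSegment ℝ (X c) (X d)) := by
  wlog hlt : a < b generalizing a b
  · rw [openSegment_symm ℝ (X a)]
    exact this (symm _ _ hab) ab.symm (by rwa [Sym2.eq_swap])
      (lt_of_le_of_ne (not_lt.1 hlt) ab.symm)
  wlog hlt' : c < d generalizing c d
  · rw [openSegment_symm ℝ (X c)]
    exact this (symm _ _ hcd) cd.symm (by rwa [Sym2.eq_swap (a := d)])
      (lt_of_le_of_ne (not_lt.1 hlt') cd.symm)
  by_cases h1 : b ≤ c
  · exact disjoint_openSegment_of_fst (h.mono _ _ hlt) (h.monotone h1) (h.mono _ _ hlt')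
  by_cases h2 : d ≤ a
  · exact (disjoint_openSegment_of_fst (h.mono _ _ hlt') (h.monotone h2) (h.mono _ _ hlt)).symm
  rw [not_le] at h1 h2
  have hne' : ¬(a = c ∧ b = d) := by rintro ⟨rfl, rfl⟩; exact hne rfl
  rcases le_or_gt a c with h3 | h3
  · rcases le_or_gt d b with h4 | h4
    · exact h.disjoint_nested h3 hlt' h4 hne'
    · rcases h3.eq_or_lt with rfl | h3
      · exact (h.disjoint_nested le_rfl hlt h4.le fun e => hne' ⟨rfl, e.2.symm⟩).symm
      · exact (nc _ _ _ _ hab hcd h3 h1 h4).elim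
  · rcases le_or_gt b d with h4 | h4
    · exact (h.disjoint_nested h3.le hlt h4 fun e => hne' ⟨e.1.symm, e.2.symm⟩).symm
    · exact (nc _ _ _ _ hcd hab h3 h2 h4).elim

/-- A chord of a chain does not meet a segment between the opposite points. -/
theorem disjoint_chord_opposite (h : IsBulgingChain σ X Y) {a b : Fin n} (ab : a ≠ b)
    (c d : Fin n) : Disjoint (openSegment ℝ (X a) (X b)) (openSegment ℝ (Y c) (Y d)) := by
  wlog hlt : a < b generalizing a b
  · rw [openSegment_symm ℝ (X a)]
    exact this ab.symm (lt_of_le_of_ne (not_lt.1 hlt) ab.symm)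
  refine disjoint_openSegment_of_orient σ (X a) (X b) ?_ ?_ ?_ ?_ ?_
  · simp [orient_left]
  · simp [orient_right]
  · exact (h.opposite _ _ _ hlt).le
  · exact (h.opposite _ _ _ hlt).le
  · exact Or.inr (Or.inr (Or.inl (h.opposite _ _ _ hlt).ne))

/-- A chord of a chain does not meet a segment from the chain to an opposite point. -/
theorem disjoint_chord_cross (h : IsBulgingChain σ X Y) {a b : Fin n} (ab : a ≠ b) (c d : Fin n) :
    Disjoint (openSegment ℝ (X a) (X b)) (openSegment ℝ (X c) (Y d)) := by
  wlog hlt : a < b generalizing a b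
  · rw [openSegment_symm ℝ (X a)]
    exact this ab.symm (lt_of_le_of_ne (not_lt.1 hlt) ab.symm)
  -- If `c` is outside the range of the chord, the line through `X c` and the nearer end of the
  -- chord separates: by convexity the other end is on one side, and the opposite point is on the
  -- other.
  rcases lt_or_ge c a with hca | hac
  · refine disjoint_openSegment_of_orient σ (X c) (X a) ?_ ?_ ?_ ?_ ?_
    · simp [orient_right]
    · exact (h.orient_pos_after hca hlt).le
    · simp [orient_left]
    · exact (h.opposite _ _ _ hca).le
    · exact Or.inr (Or.inr (Or.inr (h.opposite _ _ _ hca).ne))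
  rcases lt_or_ge b c with hbc | hcb
  · refine disjoint_openSegment_of_orient σ (X b) (X c) ?_ ?_ ?_ ?_ ?_
    · exact (h.orient_pos_before hlt hbc).le
    · simp [orient_left]
    · simp [orient_right]
    · exact (h.opposite _ _ _ hbc).le
    · exact Or.inr (Or.inr (Or.inr (h.opposite _ _ _ hbc).ne))
  · refine disjoint_openSegment_of_orient σ (X a) (X b) ?_ ?_ ?_ ?_ ?_
    · simp [orient_left]
    · simp [orient_right]
    · exact h.middle_nonpos hac hcb
    · exact (h.opposite _ _ _ hlt).le
    · exact Or.inr (Or.inr (Or.inr (h.opposite _ _ _ hlt).ne))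

/-- A chord of a chain does not contain a point of the chain. -/
theorem notMem_chord (h : IsBulgingChain σ X Y) {a b : Fin n} (ab : a ≠ b) (c : Fin n) :
    X c ∉ openSegment ℝ (X a) (X b) := by
  wlog hlt : a < b generalizing a b
  · rw [openSegment_symm ℝ (X a)]
    exact this ab.symm (lt_of_le_of_ne (not_lt.1 hlt) ab.symm)
  have hx := h.mono _ _ hlt
  rintro ⟨s, t, hs, ht, hst, heq⟩
  have e1 := congrArg Prod.fst heq
  have e2 := congrArg Prod.snd heq
  simp only [Prod.fst_add, Prod.smul_fst, Prod.snd_add, Prod.smul_snd, smul_eq_mul] at e1 e2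
  obtain rfl : s = 1 - t := by linarith
  rcases le_or_gt c a with hca | hca
  · nlinarith [h.monotone hca]
  rcases le_or_gt b c with hbc | hbc
  · nlinarith [h.monotone hbc]
  have h1 := h.middle _ _ _ hca hbc
  refine h1.ne ?_
  unfold orient
  rw [← e1, ← e2]
  ring

/-- A chord of a chain does not contain an opposite point. -/
theorem notMem_chord_opposite (h : IsBulgingChain σ X Y) {a b : Fin n} (ab : a ≠ b) (c : Fin n) :
    Y c ∉ openSegment ℝ (X a) (X b) := by
  have := h.disjoint_chord_opposite ab c c
  rw [openSegment_same, Set.disjoint_singleton_right] at this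
  exact this

/-- A segment between the chains does not contain a point of the chain. -/
theorem notMem_cross (h : IsBulgingChain σ X Y) (a b : Fin n) (c : Fin n) (hne : X a ≠ Y b) :
    X c ∉ openSegment ℝ (X a) (Y b) := by
  rcases lt_trichotomy c a with hca | rfl | hca
  -- The point is regarded as a degenerate segment, so that the separation criterion applies.
  · have : Disjoint (openSegment ℝ (X c) (X c)) (openSegment ℝ (X a) (Y b)) := by
      refine disjoint_openSegment_of_orient σ (X c) (X a) ?_ ?_ ?_ ?_ ?_
      · simp [orient_left]
      · simp [orient_left]
      · simp [orient_right]
      · exact (h.opposite _ _ _ hca).le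
      · exact Or.inr (Or.inr (Or.inr (h.opposite _ _ _ hca).ne))
    rwa [openSegment_same, Set.disjoint_singleton_left] at this
  · rw [left_mem_openSegment_iff]
    exact hne
  · have : Disjoint (openSegment ℝ (X c) (X c)) (openSegment ℝ (X a) (Y b)) := by
      refine disjoint_openSegment_of_orient σ (X a) (X c) ?_ ?_ ?_ ?_ ?_
      · simp [orient_right]
      · simp [orient_right]
      · simp [orient_left]
      · exact (h.opposite _ _ _ hca).le
      · exact Or.inr (Or.inr (Or.inr (h.opposite _ _ _ hca).ne))
    rwa [openSegment_same, Set.disjoint_singleton_left] at this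

end IsBulgingChain

/-- Here `s`, `t` are the parameters of a common point on two segments between the chains, and `h`,
`h'`, `k`, `k'` are vertical distances of ends from the chords of the opposite chains. Both
distances change in the direction of the sign of `m`, a difference of slopes. The first equation
then pushes `s - t` to one side of 0 and the second to the other. -/
theorem eq_of_proportional_heights {s t h h' k k' m p q : ℝ} (ht : 0 ≤ t)
    (ht' : 0 ≤ 1 - t) (hh : 0 < h) (hk : 0 < k) (hp : 0 < p) (hq : 0 < q)
    (dh : h' - h = m * p) (dk : k' - k = m * q) (eh : s * h = t * h')
    (ek : (1 - s) * k = (1 - t) * k') : s = t := by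
  have e1 : (s - t) * h = t * (m * p) := by rw [← dh]; linarith
  have e2 : (t - s) * k = (1 - t) * (m * q) := by rw [← dk]; linarith
  rcases le_total 0 m with hm | hm
  · have f1 : 0 ≤ (s - t) * h := e1 ▸ mul_nonneg ht (mul_nonneg hm hp.le)
    have f2 : 0 ≤ (t - s) * k := e2 ▸ mul_nonneg ht' (mul_nonneg hm hq.le)
    have g1 := nonneg_of_mul_nonneg_left f1 hh
    have g2 := nonneg_of_mul_nonneg_left f2 hk
    linarith
  · have f1 : 0 ≤ (t - s) * h := by
      have := mul_nonneg ht (mul_nonneg (neg_nonneg.2 hm) hp.le)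
      linarith
    have f2 : 0 ≤ (s - t) * k := by
      have := mul_nonneg ht' (mul_nonneg (neg_nonneg.2 hm) hq.le)
      linarith
    have g1 := nonneg_of_mul_nonneg_left f1 hh
    have g2 := nonneg_of_mul_nonneg_left f2 hk
    linarith

/-- Two segments between the chains that respect the order do not meet. -/
theorem disjoint_cross_cross {n : ℕ} {X Y : Fin n → ℝ × ℝ} (hX : IsBulgingChain 1 X Y)
    (hY : IsBulgingChain (-1) Y X) {a b c d : Fin n} (hac : a < c) (hbd : b < d) :
    Disjoint (openSegment ℝ (X a) (Y b)) (openSegment ℝ (X c) (Y d)) := by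
  have x1 := hX.mono _ _ hac
  have x2 := hY.mono _ _ hbd
  have o1 := hX.opposite a c b hac
  have o3 := hY.opposite b d a hbd
  rw [Set.disjoint_left]
  rintro _ ⟨s', s, hs', hs, hss, rfl⟩ ⟨t', t, ht', ht, htt, heq⟩
  have e1 := congrArg Prod.fst heq
  have e2 := congrArg Prod.snd heq
  simp only [Prod.fst_add, Prod.smul_fst, Prod.snd_add, Prod.smul_snd, smul_eq_mul] at e1 e2
  obtain rfl : s' = 1 - s := by linarith
  obtain rfl : t' = 1 - t := by linarith
  obtain ⟨u, hu⟩ : ∃ u, (X c).2 - (X a).2 = u * ((X c).1 - (X a).1) :=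
    ⟨_, (div_mul_cancel₀ _ (sub_pos.2 x1).ne').symm⟩
  obtain ⟨l, hl⟩ : ∃ l, (Y d).2 - (Y b).2 = l * ((Y d).1 - (Y b).1) :=
    ⟨_, (div_mul_cancel₀ _ (sub_pos.2 x2).ne').symm⟩
  simp only [orient, hu, hl] at o1 o3
  -- the vertical distances of the four points from the line through the other two points
  have h1 : 0 < u * ((Y b).1 - (X a).1) - ((Y b).2 - (X a).2) :=
    (mul_pos_iff_of_pos_left (sub_pos.2 x1)).1 (by linarith)
  have k1 : 0 < ((X a).2 - (Y b).2) - l * ((X a).1 - (Y b).1) :=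
    (mul_pos_iff_of_pos_left (sub_pos.2 x2)).1 (by linarith)
  set H1 := u * ((Y b).1 - (X a).1) - ((Y b).2 - (X a).2) with hH1
  set H2 := u * ((Y d).1 - (X a).1) - ((Y d).2 - (X a).2) with hH2
  set K1 := ((X a).2 - (Y b).2) - l * ((X a).1 - (Y b).1) with hK1
  set K2 := ((X c).2 - (Y b).2) - l * ((X c).1 - (Y b).1) with hK2
  have dH : H2 - H1 = (u - l) * ((Y d).1 - (Y b).1) := by
    rw [hH1, hH2]
    linear_combination -hl
  have dK : K2 - K1 = (u - l) * ((X c).1 - (X a).1) := by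
    rw [hK1, hK2]
    linear_combination hu
  have eH : s * H1 = t * H2 := by
    rw [hH1, hH2]
    linear_combination e2 - u * e1 - (1 - t) * hu
  have eK : (1 - s) * K1 = (1 - t) * K2 := by
    rw [hK1, hK2]
    linear_combination l * e1 - e2 + t * hl
  obtain rfl : s = t := eq_of_proportional_heights ht.le ht'.le h1 k1
    (sub_pos.2 x2) (sub_pos.2 x1) dH dK eH eK
  -- At equal parameters the second segment is strictly to the right of the first, against `e1`.
  nlinarith [mul_pos hs' (sub_pos.2 x1), mul_pos hs (sub_pos.2 x2)]

/-! ### Reduction to graphs on two ordered chains. -/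

/-- The combinatorial form of non-crossing for graphs on the points of a double chain, both chains
being enumerated from left to right, in which the edges between the chains form a matching. -/
structure IsOrderNonCrossing {n : ℕ} (G : SimpleGraph (Fin n ⊕ Fin n)) : Prop where
  upper : ∀ a b c d, G.Adj (.inl a) (.inl b) → G.Adj (.inl c) (.inl d) →
    a < c → c < b → b < d → False
  lower : ∀ a b c d, G.Adj (.inr a) (.inr b) → G.Adj (.inr c) (.inr d) →
    a < c → c < b → b < d → False
  cross : ∀ a b c d, G.Adj (.inl a) (.inr b) → G.Adj (.inl c) (.inr d) →
    (a < c ∧ b < d) ∨ (c < a ∧ d < b) ∨ (a = c ∧ b = d)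

/-- The order conditions are needed only for two chords of one chain and for two segments between
the chains; all other pairs are disjoint by the geometry alone. -/
theorem IsOrderNonCrossing.disjoint_openSegment {n : ℕ} {G : SimpleGraph (Fin n ⊕ Fin n)}
    (hG : IsOrderNonCrossing G) {X Y : Fin n → ℝ × ℝ} (hX : IsBulgingChain 1 X Y)
    (hY : IsBulgingChain (-1) Y X) {a b c d : Fin n ⊕ Fin n} (hab : G.Adj a b) (hcd : G.Adj c d)
    (hne : s(a, b) ≠ s(c, d)) :
    Disjoint (openSegment ℝ (Sum.elim X Y a) (Sum.elim X Y b))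
      (openSegment ℝ (Sum.elim X Y c) (Sum.elim X Y d)) := by
  have cross : ∀ a b c d, G.Adj (.inl a) (.inr b) → G.Adj (.inl c) (.inr d) →
      s((Sum.inl a : Fin n ⊕ Fin n), .inr b) ≠ s(.inl c, .inr d) →
      Disjoint (openSegment ℝ (X a) (Y b)) (openSegment ℝ (X c) (Y d)) := by
    intro a b c d hab hcd hne
    rcases hG.cross _ _ _ _ hab hcd with ⟨h1, h2⟩ | ⟨h1, h2⟩ | ⟨rfl, rfl⟩
    · exact disjoint_cross_cross hX hY h1 h2
    · exact (disjoint_cross_cross hX hY h1 h2).symm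
    · exact absurd rfl hne
  have neX : ∀ {a b}, G.Adj (.inl a) (.inl b) → a ≠ b := fun h e => h.ne (congrArg _ e)
  have neY : ∀ {a b}, G.Adj (.inr a) (.inr b) → a ≠ b := fun h e => h.ne (congrArg _ e)
  have cX := fun a b c d => hX.disjoint_chords (a := a) (b := b) (c := c) (d := d)
    (R := fun a b => G.Adj (.inl a) (.inl b)) (fun a b => .symm)
    hG.upper
  have cY := fun a b c d => hY.disjoint_chords (a := a) (b := b) (c := c) (d := d)
    (R := fun a b => G.Adj (.inr a) (.inr b)) (fun a b => .symm)
    hG.lower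
  rcases a with a | a <;> rcases b with b | b <;> rcases c with c | c <;> rcases d with d | d <;>
    simp only [Sum.elim_inl, Sum.elim_inr]
  · exact cX _ _ _ _ hab hcd (neX hab) (neX hcd) (by simpa using hne)
  · exact hX.disjoint_chord_cross (neX hab) _ _
  · rw [openSegment_symm ℝ (Y c)]
    exact hX.disjoint_chord_cross (neX hab) _ _
  · exact hX.disjoint_chord_opposite (neX hab) _ _
  · exact (hX.disjoint_chord_cross (neX hcd) _ _).symm
  · exact cross _ _ _ _ hab hcd hne
  · rw [openSegment_symm ℝ (Y c)]
    exact cross _ _ _ _ hab hcd.symm (by rwa [Sym2.eq_swap (a := Sum.inl d)])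
  · rw [openSegment_symm ℝ (X a)]
    exact (hY.disjoint_chord_cross (neY hcd) _ _).symm
  · rw [openSegment_symm ℝ (Y a)]
    exact (hX.disjoint_chord_cross (neX hcd) _ _).symm
  · rw [openSegment_symm ℝ (Y a)]
    exact cross _ _ _ _ hab.symm hcd (by rwa [Sym2.eq_swap (a := Sum.inl b)])
  · rw [openSegment_symm ℝ (Y a), openSegment_symm ℝ (Y c)]
    exact cross _ _ _ _ hab.symm hcd.symm
      (by rwa [Sym2.eq_swap (a := Sum.inl b), Sym2.eq_swap (a := Sum.inl d)])
  · exact (hY.disjoint_chord_cross (neY hcd) _ _).symm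
  · exact hY.disjoint_chord_opposite (neY hab) _ _
  · rw [openSegment_symm ℝ (X c)]
    exact hY.disjoint_chord_cross (neY hab) _ _
  · exact hY.disjoint_chord_cross (neY hab) _ _
  · exact cY _ _ _ _ hab hcd (neY hab) (neY hcd) (by simpa using hne)

theorem notMem_openSegment_of_adj {n : ℕ} {G : SimpleGraph (Fin n ⊕ Fin n)}
    {X Y : Fin n → ℝ × ℝ} (hX : IsBulgingChain 1 X Y) (hY : IsBulgingChain (-1) Y X)
    (hXY : ∀ i j, X i ≠ Y j) {a b : Fin n ⊕ Fin n} (hab : G.Adj a b) (v : Fin n ⊕ Fin n) :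
    Sum.elim X Y v ∉ openSegment ℝ (Sum.elim X Y a) (Sum.elim X Y b) := by
  have neX : ∀ {a b}, G.Adj (.inl a) (.inl b) → a ≠ b := fun h e => h.ne (congrArg _ e)
  have neY : ∀ {a b}, G.Adj (.inr a) (.inr b) → a ≠ b := fun h e => h.ne (congrArg _ e)
  rcases a with a | a <;> rcases b with b | b <;> rcases v with v | v <;>
    simp only [Sum.elim_inl, Sum.elim_inr]
  · exact hX.notMem_chord (neX hab) _
  · exact hX.notMem_chord_opposite (neX hab) _
  · exact hX.notMem_cross _ _ _ (hXY _ _)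
  · rw [openSegment_symm]
    exact hY.notMem_cross _ _ _ (hXY _ _).symm
  · rw [openSegment_symm]
    exact hX.notMem_cross _ _ _ (hXY _ _)
  · exact hY.notMem_cross _ _ _ (hXY _ _).symm
  · exact hY.notMem_chord_opposite (neY hab) _
  · exact hY.notMem_chord (neY hab) _

/-- The points of a finite set without two points on a vertical line can be enumerated from left
to right. -/
theorem exists_enumeration_by_fst {n : ℕ} (U : Finset (ℝ × ℝ)) (hU : U.card = n)
    (hinj : Set.InjOn Prod.fst (U : Set (ℝ × ℝ))) :
    ∃ X : Fin n → ℝ × ℝ, (∀ i j, i < j → (X i).1 < (X j).1) ∧ Set.range X = U := by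
  classical
  have hc : (U.image Prod.fst).card = n := by rw [Finset.card_image_of_injOn hinj, hU]
  let f := (U.image Prod.fst).orderEmbOfFin hc
  have hf : ∀ i, ∃ p ∈ U, p.1 = f i := fun i =>
    Finset.mem_image.1 ((U.image Prod.fst).orderEmbOfFin_mem hc i)
  choose X hXU hXf using hf
  refine ⟨X, fun i j hij => ?_, ?_⟩
  · rw [hXf, hXf]
    exact f.strictMono hij
  · apply Set.Subset.antisymm
    · rintro _ ⟨i, rfl⟩
      exact hXU i
    · intro p hp
      have : p.1 ∈ Set.range f := by
        rw [Finset.range_orderEmbOfFin]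
        exact Finset.mem_coe.2 (Finset.mem_image_of_mem _ hp)
      obtain ⟨i, hi⟩ := this
      exact ⟨i, hinj (hXU i) hp ((hXf i).trans hi)⟩

/-- A double chain, enumerated. -/
theorem IsDoubleChain.exists_enumeration {n : ℕ} (hn : 0 < n) {D : Finset (ℝ × ℝ)}
    (hD : IsDoubleChain n D) : ∃ X Y : Fin n → ℝ × ℝ, IsBulgingChain 1 X Y ∧
      IsBulgingChain (-1) Y X ∧ (∀ i j, X i ≠ Y j) ∧
      (D : Set (ℝ × ℝ)) = Set.range (Sum.elim X Y) := by
  obtain ⟨U, L, h, hD⟩ := hD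
  obtain ⟨u, hu⟩ := Finset.card_pos.1 (h.card_upper.symm ▸ hn)
  obtain ⟨l, hl⟩ := Finset.card_pos.1 (h.card_lower.symm ▸ hn)
  obtain ⟨X, hX, hXU⟩ := exists_enumeration_by_fst U h.card_upper (fun p hp q hq hpq => by
    by_contra hne
    exact (h.lower_below p hp q hq hne l hl).1 hpq)
  obtain ⟨Y, hY, hYL⟩ := exists_enumeration_by_fst L h.card_lower (fun p hp q hq hpq => by
    by_contra hne
    exact (h.upper_above p hp q hq hne u hu).1 hpq)
  have mX : ∀ i, X i ∈ U := fun i => Finset.mem_coe.1 (hXU ▸ Set.mem_range_self i)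
  have mY : ∀ i, Y i ∈ L := fun i => Finset.mem_coe.1 (hYL ▸ Set.mem_range_self i)
  refine ⟨X, Y, ⟨hX, ?_, ?_⟩, ⟨hY, ?_, ?_⟩, ?_, ?_⟩
  · intro i j k hij hjk
    rw [one_mul]
    exact (h.upper_convex _ (mX i) _ (mX j) _ (mX k) (hX _ _ hij) (hX _ _ hjk)).orient_neg
      (hX _ _ (hij.trans hjk))
  · intro i j k hij
    rw [one_mul]
    exact (h.lower_below _ (mX i) _ (mX j) (fun e => (hX _ _ hij).ne (congrArg _ e)) _
      (mY k)).orient_neg (hX _ _ hij)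
  · intro i j k hij hjk
    have := (h.lower_concave _ (mY i) _ (mY j) _ (mY k) (hY _ _ hij) (hY _ _ hjk)).orient_pos
      (hY _ _ (hij.trans hjk))
    linarith
  · intro i j k hij
    have := (h.upper_above _ (mY i) _ (mY j) (fun e => (hY _ _ hij).ne (congrArg _ e)) _
      (mX k)).orient_pos (hY _ _ hij)
    linarith
  · intro i j e
    exact Finset.disjoint_left.1 h.disjoint (mX i) (e ▸ mY j)
  · rw [hD, Set.Sum.elim_range, hXU, hYL]

/-- Graphs on `Fin n ⊕ Fin n` that are non-crossing path partitions of every double chain for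
combinatorial reasons. -/
structure IsOrderNCP {n : ℕ} (G : SimpleGraph (Fin n ⊕ Fin n)) : Prop where
  nonCrossing : IsOrderNonCrossing G
  coords : ∃ (K : Type) (κ : Fin n ⊕ Fin n → K) (d : Fin n ⊕ Fin n → ℤ),
    (∀ x y, κ x = κ y → d x = d y → x = y) ∧ ∀ x y, G.Adj x y ↔ κ x = κ y ∧ |d x - d y| = 1

/-- Such graphs are non-crossing path partitions, after an enumeration of the double chain. -/
theorem IsDoubleChain.exists_equiv {n : ℕ} (hn : 0 < n) {D : Finset (ℝ × ℝ)}
    (hD : IsDoubleChain n D) : ∃ e : D ≃ Fin n ⊕ Fin n,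
      ∀ G : SimpleGraph (Fin n ⊕ Fin n), IsOrderNCP G → IsNCP (G.comap e) := by
  obtain ⟨X, Y, hX, hY, hXY, hD⟩ := hD.exists_enumeration hn
  have inj : Function.Injective (Sum.elim X Y) :=
    Function.Injective.sumElim hX.injective hY.injective hXY
  let e : Fin n ⊕ Fin n ≃ D :=
    (Equiv.ofInjective _ inj).trans (Equiv.setCongr hD.symm)
  have he : ∀ x : D, Sum.elim X Y (e.symm x) = x := by
    intro x
    have : ((e (e.symm x) : D) : ℝ × ℝ) = x := by rw [e.apply_symm_apply]
    exact this
  refine ⟨e.symm, fun G hG => ⟨⟨?_, ?_⟩, ?_⟩⟩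
  · intro a b v hab
    rw [← he a, ← he b, ← he v]
    exact notMem_openSegment_of_adj hX hY hXY (SimpleGraph.comap_adj.1 hab) _
  · intro a b c d hab hcd hne
    rw [← he a, ← he b, ← he c, ← he d]
    refine hG.nonCrossing.disjoint_openSegment hX hY (SimpleGraph.comap_adj.1 hab)
      (SimpleGraph.comap_adj.1 hcd) fun h => hne ?_
    have := congrArg (Sym2.map e) h
    simpa using this
  · obtain ⟨K, κ, d, h1, h2⟩ := hG.coords
    exact component_iso_pathGraph _ (κ ∘ e.symm) (d ∘ e.symm)
      (fun x y hk hd => e.symm.injective (h1 _ _ hk hd)) fun x y => h2 _ _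

theorem SimpleGraph.comap_equiv_injective {V W : Type*} (e : V ≃ W) :
    Function.Injective (SimpleGraph.comap e : SimpleGraph W → SimpleGraph V) := by
  intro G G' h
  ext x y
  have := congrArg (fun H : SimpleGraph V => H.Adj (e.symm x) (e.symm y)) h
  simpa using this

theorem IsDoubleChain.ncard_le_numNCP {n : ℕ} (hn : 0 < n) {D : Finset (ℝ × ℝ)}
    (hD : IsDoubleChain n D) :
    {G : SimpleGraph (Fin n ⊕ Fin n) | IsOrderNCP G}.ncard ≤ numNCP D := by
  obtain ⟨e, he⟩ := hD.exists_equiv hn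
  refine Set.ncard_le_ncard_of_injOn (SimpleGraph.comap e) he ?_ (Set.toFinite _)
  exact (SimpleGraph.comap_equiv_injective e).injOn

theorem IsDoubleChain.ncard_le_numNCPWS {n : ℕ} (hn : 0 < n) {D : Finset (ℝ × ℝ)}
    (hD : IsDoubleChain n D) :
    {G : SimpleGraph (Fin n ⊕ Fin n) | IsOrderNCP G ∧ ∀ v, ∃ w, G.Adj v w}.ncard ≤ numNCPWS D := by
  obtain ⟨e, he⟩ := hD.exists_equiv hn
  refine Set.ncard_le_ncard_of_injOn (SimpleGraph.comap e) ?_ ?_ (Set.toFinite _)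
  · rintro G ⟨hG, hG'⟩
    refine ⟨he G hG, fun v => ?_⟩
    obtain ⟨w, hw⟩ := hG' (e v)
    exact ⟨e.symm w, by simpa using hw⟩
  · exact (SimpleGraph.comap_equiv_injective e).injOn

/-! ### Shapes of paths on at most four points. -/

/-- Two positions on a path are consecutive. -/
def Consecutive (p q : ℕ) : Prop := p + 1 = q ∨ q + 1 = p

instance (p q : ℕ) : Decidable (Consecutive p q) := inferInstanceAs (Decidable (_ ∨ _))

theorem Consecutive.symm {p q : ℕ} (h : Consecutive p q) : Consecutive q p := Or.symm h

theorem consecutive_iff_abs {p q : ℕ} : Consecutive p q ↔ |(p : ℤ) - q| = 1 := by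
  unfold Consecutive
  rw [abs_eq (by norm_num)]
  omega

/-- The non-crossing spanning paths of at most four points in convex position, up to orientation.
A path is given by the list of the positions of the points on it. -/
def pathShapes : Finset (List ℕ) :=
  {[0], [0, 1], [0, 1, 2], [0, 2, 1], [1, 0, 2], [0, 1, 2, 3], [0, 1, 3, 2], [0, 2, 3, 1],
    [0, 3, 2, 1], [1, 0, 2, 3], [1, 0, 3, 2], [2, 0, 1, 3], [2, 1, 0, 3]}

/-- The non-crossing spanning paths of at most four points in convex position, with an
orientation. -/
def orientedPathShapes : Finset (List ℕ) :=
  pathShapes ∪ {[1, 0], [1, 2, 0], [2, 0, 1], [2, 1, 0], [1, 2, 3, 0], [1, 3, 2, 0], [2, 3, 0, 1],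
    [2, 3, 1, 0], [3, 0, 1, 2], [3, 1, 0, 2], [3, 2, 0, 1], [3, 2, 1, 0]}

theorem shape_length_pos : ∀ pos ∈ orientedPathShapes, 0 < pos.length := by decide

theorem shape_nodup : ∀ pos ∈ orientedPathShapes, pos.Nodup := by decide

theorem shape_mem_iff : ∀ pos ∈ orientedPathShapes, ∀ p, p ∈ pos ↔ p < pos.length := by
  have h : ∀ pos ∈ orientedPathShapes, (∀ p ∈ pos, p < pos.length) ∧
      ∀ p < pos.length, p ∈ pos := by decide
  exact fun pos hpos p => ⟨(h pos hpos).1 p, (h pos hpos).2 p⟩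

/-- The indices are ordered backwards, `d < b < c < a`, because they will refer to the stack, which
lists the points from right to left. -/
theorem shape_nonCrossing : ∀ pos ∈ orientedPathShapes, ∀ a < pos.length, ∀ c < a, ∀ b < c,
    ∀ d < b, Consecutive (pos.getD a 0) (pos.getD b 0) →
      ¬Consecutive (pos.getD c 0) (pos.getD d 0) := by decide +kernel

/-- The mark sits at position 0 and so reveals the orientation; this is why marked paths may use all
oriented shapes. -/
theorem shape_ext_of_root : ∀ pos ∈ orientedPathShapes, ∀ pos' ∈ orientedPathShapes,
    pos.length = pos'.length →
    (∀ i < pos.length, ∀ j < pos.length, Consecutive (pos.getD i 0) (pos.getD j 0) ↔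
      Consecutive (pos'.getD i 0) (pos'.getD j 0)) →
    (∀ i < pos.length, pos.getD i 0 = 0 ↔ pos'.getD i 0 = 0) → pos = pos' := by
  decide +kernel

/-- Without a mark, a path and its reversal have the same edges, so only one of the two is admitted.
-/
theorem shape_ext : ∀ pos ∈ pathShapes, ∀ pos' ∈ pathShapes,
    pos.length = pos'.length →
    (∀ i < pos.length, ∀ j < pos.length, Consecutive (pos.getD i 0) (pos.getD j 0) ↔
      Consecutive (pos'.getD i 0) (pos'.getD j 0)) → pos = pos' := by
  decide +kernel

/-- The point `x` of the list `L` has position `p` on the path. -/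
def PosAt (L pos : List ℕ) (x p : ℕ) : Prop := ∃ i : ℕ, L[i]? = some x ∧ pos[i]? = some p

/-- The point `x` is on the path. -/
def InBlock (L pos : List ℕ) (x : ℕ) : Prop := ∃ p, PosAt L pos x p

namespace PosAt

variable {L pos : List ℕ} {x y p q : ℕ}

theorem inBlock (h : PosAt L pos x p) : InBlock L pos x := ⟨p, h⟩

theorem mem (h : PosAt L pos x p) : x ∈ L := by
  obtain ⟨i, hi, -⟩ := h
  exact List.mem_of_getElem? hi

theorem lt_iff {i j : ℕ} (hL : L.Pairwise (· > ·)) (hi : L[i]? = some x) (hj : L[j]? = some y) :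
    x < y ↔ j < i := by
  obtain ⟨hi', rfl⟩ := List.getElem?_eq_some_iff.1 hi
  obtain ⟨hj', rfl⟩ := List.getElem?_eq_some_iff.1 hj
  have h := List.pairwise_iff_getElem.1 hL
  constructor
  · intro hlt
    by_contra hn
    rcases (not_lt.1 hn).eq_or_lt with rfl | h'
    · exact lt_irrefl _ hlt
    · exact lt_asymm hlt (h _ _ hi' hj' h')
  · exact h _ _ hj' hi'

theorem index_eq {i j : ℕ} (hL : L.Pairwise (· > ·)) (hi : L[i]? = some x)
    (hj : L[j]? = some x) : i = j := by
  have h1 := lt_iff hL hi hj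
  have h2 := lt_iff hL hj hi
  simp only [lt_irrefl, false_iff, not_lt] at h1 h2
  exact le_antisymm h1 h2

theorem pos_eq (hL : L.Pairwise (· > ·)) (h : PosAt L pos x p) (h' : PosAt L pos x q) :
    p = q := by
  obtain ⟨i, hi, hip⟩ := h
  obtain ⟨j, hj, hjq⟩ := h'
  obtain rfl := index_eq hL hi hj
  exact Option.some.inj (hip.symm.trans hjq)

theorem point_eq (hpos : pos ∈ orientedPathShapes) (h : PosAt L pos x p) (h' : PosAt L pos y p) :
    x = y := by
  obtain ⟨i, hi, hip⟩ := h
  obtain ⟨j, hj, hjp⟩ := h'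
  obtain ⟨hi', rfl⟩ := List.getElem?_eq_some_iff.1 hip
  obtain ⟨hj', h⟩ := List.getElem?_eq_some_iff.1 hjp
  obtain rfl := (shape_nodup pos hpos).getElem_inj_iff.1 h
  exact Option.some.inj (hi.symm.trans hj)

theorem exists_of_lt (hpos : pos ∈ orientedPathShapes) (hlen : pos.length ≤ L.length)
    (hp : p < pos.length) : ∃ x, PosAt L pos x p := by
  obtain ⟨i, hi, rfl⟩ := List.mem_iff_getElem.1 ((shape_mem_iff pos hpos p).2 hp)
  exact ⟨L[i], i, List.getElem?_eq_getElem (hi.trans_le hlen), List.getElem?_eq_getElem hi⟩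

theorem lt_length (hpos : pos ∈ orientedPathShapes) (h : PosAt L pos x p) : p < pos.length := by
  obtain ⟨i, -, hi⟩ := h
  exact (shape_mem_iff pos hpos p).1 (List.mem_of_getElem? hi)

theorem not_crossing (hL : L.Pairwise (· > ·)) (hpos : pos ∈ orientedPathShapes)
    {a b c d p q r t : ℕ} (ha : PosAt L pos a p) (hb : PosAt L pos b q) (hc : PosAt L pos c r)
    (hd : PosAt L pos d t) (hpq : Consecutive p q) (hrt : Consecutive r t) (hac : a < c)
    (hcb : c < b) (hbd : b < d) : False := by
  obtain ⟨i, hi, hip⟩ := ha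
  obtain ⟨j, hj, hjq⟩ := hb
  obtain ⟨k, hk, hkr⟩ := hc
  obtain ⟨l, hl, hlt⟩ := hd
  refine shape_nonCrossing pos hpos i (List.getElem?_eq_some_iff.1 hip).1 k
    ((lt_iff hL hi hk).1 hac) j ((lt_iff hL hk hj).1 hcb) l ((lt_iff hL hj hl).1 hbd) ?_ ?_
  · simpa [List.getD_eq_getElem?_getD, hip, hjq] using hpq
  · simpa [List.getD_eq_getElem?_getD, hkr, hlt] using hrt

/-- A path is connected. -/
theorem mem_of_closed (hpos : pos ∈ orientedPathShapes) (hlen : pos.length ≤ L.length)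
    {A : ℕ → Prop}
    (hA : ∀ x y p q, PosAt L pos x p → PosAt L pos y q → Consecutive p q → A x → A y)
    (hx : PosAt L pos x p) (hAx : A x) (hy : PosAt L pos y q) : A y := by
  obtain ⟨r, hr⟩ := exists_of_lt hpos hlen (shape_length_pos pos hpos)
  have key : ∀ p, p < pos.length → ∀ x, PosAt L pos x p → (A x ↔ A r) := by
    intro p
    induction p with
    | zero =>
      intro _ x hx
      rw [point_eq hpos hx hr]
    | succ p ih =>
      intro hp x hx
      obtain ⟨y, hy⟩ := exists_of_lt (L := L) (p := p) hpos hlen (by omega)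
      rw [← ih (by omega) y hy]
      exact ⟨hA _ _ _ _ hx hy (Or.inr rfl), hA _ _ _ _ hy hx (Or.inl rfl)⟩
  exact (key _ (hy.lt_length hpos) _ hy).2 ((key _ (hx.lt_length hpos) _ hx).1 hAx)

end PosAt

theorem inBlock_iff_mem_take {L pos : List ℕ} {x : ℕ} :
    InBlock L pos x ↔ x ∈ L.take pos.length := by
  rw [List.mem_iff_getElem?]
  constructor
  · rintro ⟨p, i, hi, hip⟩
    have := (List.getElem?_eq_some_iff.1 hip).1
    exact ⟨i, by rw [List.getElem?_take_of_lt this, hi]⟩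
  · rintro ⟨i, hi⟩
    by_cases h : i < pos.length
    · rw [List.getElem?_take_of_lt h] at hi
      exact ⟨pos[i], i, hi, List.getElem?_eq_getElem h⟩
    · rw [List.getElem?_eq_none (by simp; omega)] at hi
      exact absurd hi (by simp)

theorem inBlock_or_mem_drop {L pos : List ℕ} {x : ℕ} :
    x ∈ L ↔ InBlock L pos x ∨ x ∈ L.drop pos.length := by
  rw [inBlock_iff_mem_take, ← List.mem_append, List.take_append_drop]

theorem lt_of_mem_drop_of_inBlock {L pos : List ℕ} (hL : L.Pairwise (· > ·)) {x t : ℕ}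
    (ht : t ∈ L.drop pos.length) (hx : InBlock L pos x) : t < x := by
  rw [← List.take_append_drop pos.length L, List.pairwise_append] at hL
  exact hL.2.2 x (inBlock_iff_mem_take.1 hx) t ht

/-! ### The scan with a stack and its invariants. -/

/-- The part of a family of disjoint non-crossing paths, some of them with one marked end, that
has been built after scanning some points from left to right. The points on the stack have been
scanned, but are still to be put on a path. -/
@[ext]
structure PartialPaths where
  adj : ℕ → ℕ → Prop
  marked : ℕ → Prop
  stack : List ℕ

namespace PartialPaths

/-- Put the new point `n` on the stack. -/
def push (n : ℕ) (s : PartialPaths) : PartialPaths where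
  adj := s.adj
  marked := s.marked
  stack := n :: s.stack

/-- Form a path of the new point `n` and points from the top of the stack, and possibly mark its
first point. -/
def close (n : ℕ) (pos : List ℕ) (m : Bool) (s : PartialPaths) : PartialPaths where
  adj x y := s.adj x y ∨
    ∃ p q, PosAt (n :: s.stack) pos x p ∧ PosAt (n :: s.stack) pos y q ∧ Consecutive p q
  marked x := s.marked x ∨ (m = true ∧ PosAt (n :: s.stack) pos x 0)
  stack := (n :: s.stack).drop pos.length

/-- The invariants of the construction, after scanning the points `0, …, n - 1`. -/
structure IsGood (n : ℕ) (s : PartialPaths) : Prop where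
  symm : ∀ x y, s.adj x y → s.adj y x
  lt_of_adj : ∀ x y, s.adj x y → x < n
  lt_of_marked : ∀ x, s.marked x → x < n
  sorted : (n :: s.stack).Pairwise (· > ·)
  not_adj : ∀ x ∈ s.stack, ∀ y, ¬s.adj x y
  not_marked : ∀ x ∈ s.stack, ¬s.marked x
  -- No edge passes over a point on the stack, so paths formed later cannot cross earlier ones.
  uncovered : ∀ x y, s.adj x y → ∀ t ∈ s.stack, x < t → t < y → False
  nonCrossing : ∀ a b c d, s.adj a b → s.adj c d → a < c → c < b → b < d → False
  -- `κ` names the path of a point and `d` is the position on it. A marked path is named by its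
  -- marked point, and a point not yet on a path forms a class of its own.
  coords : ∃ κ d : ℕ → ℕ, (∀ x y, κ x = κ y → d x = d y → x = y) ∧
    (∀ x y, s.adj x y ↔ κ x = κ y ∧ Consecutive (d x) (d y)) ∧
    (∀ x, s.marked x → κ x = x ∧ d x = 0) ∧
    ∀ x, n ≤ x ∨ x ∈ s.stack → κ x = x ∧ ∀ y, κ y = x → y = x

/-- No path of the family is a single unmarked point. -/
def NoFreeSingleton (n : ℕ) (s : PartialPaths) : Prop :=
  ∀ x < n, x ∉ s.stack → s.marked x ∨ ∃ y, s.adj x y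

/-- The start of the construction. -/
def empty : PartialPaths where
  adj _ _ := False
  marked _ := False
  stack := []

theorem isGood_empty : IsGood 0 empty where
  symm _ _ h := h.elim
  lt_of_adj _ _ h := h.elim
  lt_of_marked _ h := h.elim
  sorted := by simp [empty]
  not_adj _ _ _ h := h
  not_marked _ _ h := h
  uncovered _ _ h := h.elim
  nonCrossing _ _ _ _ h := h.elim
  coords := by
    refine ⟨id, fun _ => 0, fun x y h _ => h, fun x y => ?_, fun _ h => h.elim,
      fun x _ => ⟨rfl, fun y h => h⟩⟩
    simp [empty, Consecutive]

theorem lt_of_mem_stack {n : ℕ} {s : PartialPaths} (h : IsGood n s) {x : ℕ} (hx : x ∈ s.stack) :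
    x < n := (List.pairwise_cons.1 h.sorted).1 x hx

theorem isGood_push {n : ℕ} {s : PartialPaths} (h : IsGood n s) : IsGood (n + 1) (s.push n) where
  symm := h.symm
  lt_of_adj x y hxy := (h.lt_of_adj x y hxy).trans (Nat.lt_succ_self n)
  lt_of_marked x hx := (h.lt_of_marked x hx).trans (Nat.lt_succ_self n)
  sorted := by
    refine List.pairwise_cons.2 ⟨fun x hx => ?_, h.sorted⟩
    rcases List.mem_cons.1 hx with rfl | hx
    · exact Nat.lt_succ_self _
    · exact (lt_of_mem_stack h hx).trans (Nat.lt_succ_self n)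
  not_adj x hx y hxy := by
    rcases List.mem_cons.1 hx with rfl | hx
    · exact lt_irrefl _ (h.lt_of_adj _ _ hxy)
    · exact h.not_adj x hx y hxy
  not_marked x hx hm := by
    rcases List.mem_cons.1 hx with rfl | hx
    · exact lt_irrefl _ (h.lt_of_marked _ hm)
    · exact h.not_marked x hx hm
  uncovered x y hxy t ht hxt hty := by
    rcases List.mem_cons.1 ht with rfl | ht
    · exact lt_asymm hty (h.lt_of_adj _ _ (h.symm _ _ hxy))
    · exact h.uncovered x y hxy t ht hxt hty
  nonCrossing := h.nonCrossing
  coords := by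
    obtain ⟨κ, d, h1, h2, h3, h4⟩ := h.coords
    refine ⟨κ, d, h1, h2, h3, fun x hx => h4 x ?_⟩
    rcases hx with hx | hx
    · exact Or.inl (by omega)
    · rcases List.mem_cons.1 hx with rfl | hx
      · exact Or.inl le_rfl
      · exact Or.inr hx

theorem noFreeSingleton_push {n : ℕ} {s : PartialPaths} (h : NoFreeSingleton n s) :
    NoFreeSingleton (n + 1) (s.push n) := by
  intro x hx hxs
  have : x ≠ n ∧ x ∉ s.stack := by simpa [push] using hxs
  exact h x (by omega) this.2

variable {n : ℕ} {s : PartialPaths} {pos : List ℕ} {m : Bool}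

theorem IsGood.not_adj_of_mem (h : IsGood n s) {x y : ℕ} (hx : x ∈ n :: s.stack) : ¬s.adj x y := by
  intro hxy
  rcases List.mem_cons.1 hx with rfl | hx
  · exact lt_irrefl _ (h.lt_of_adj _ _ hxy)
  · exact h.not_adj x hx y hxy

theorem IsGood.not_marked_of_mem (h : IsGood n s) {x : ℕ} (hx : x ∈ n :: s.stack) :
    ¬s.marked x := by
  intro hxy
  rcases List.mem_cons.1 hx with rfl | hx
  · exact lt_irrefl _ (h.lt_of_marked _ hxy)
  · exact h.not_marked x hx hxy

theorem IsGood.not_covered_of_mem (h : IsGood n s) {x y t : ℕ} (hxy : s.adj x y)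
    (ht : t ∈ n :: s.stack) (hxt : x < t) (hty : t < y) : False := by
  rcases List.mem_cons.1 ht with rfl | ht
  · exact lt_asymm hty (h.lt_of_adj _ _ (h.symm _ _ hxy))
  · exact h.uncovered _ _ hxy _ ht hxt hty

theorem IsGood.le_of_mem (h : IsGood n s) {x : ℕ} (hx : x ∈ n :: s.stack) : x ≤ n := by
  rcases List.mem_cons.1 hx with rfl | hx
  · exact le_rfl
  · exact (lt_of_mem_stack h hx).le

theorem inBlock_self (hpos : pos ∈ orientedPathShapes) (L : List ℕ) (n : ℕ) :
    InBlock (n :: L) pos n := by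
  rw [inBlock_iff_mem_take]
  obtain ⟨k, hk⟩ := Nat.exists_eq_succ_of_ne_zero (shape_length_pos pos hpos).ne'
  simp [hk]

/-- The new path takes the topmost points, so the remaining stack lies to its left and is not
covered by it. Old edges do not pass over its points, so they do not cross it. -/
theorem isGood_close (h : IsGood n s) (hpos : pos ∈ orientedPathShapes)
    (hlen : pos.length ≤ s.stack.length + 1) : IsGood (n + 1) (s.close n pos m) where
  symm := by
    rintro x y (hxy | ⟨p, q, hp, hq, hpq⟩)
    · exact Or.inl (h.symm _ _ hxy)
    · exact Or.inr ⟨q, p, hq, hp, hpq.symm⟩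
  lt_of_adj := by
    rintro x y (hxy | ⟨p, q, hp, hq, hpq⟩)
    · exact (h.lt_of_adj x y hxy).trans (Nat.lt_succ_self n)
    · exact Nat.lt_succ_of_le (h.le_of_mem hp.mem)
  lt_of_marked := by
    rintro x (hx | ⟨-, hx⟩)
    · exact (h.lt_of_marked x hx).trans (Nat.lt_succ_self n)
    · exact Nat.lt_succ_of_le (h.le_of_mem hx.mem)
  sorted := by
    refine List.pairwise_cons.2 ⟨fun x hx => ?_, h.sorted.sublist (List.drop_sublist _ _)⟩
    exact Nat.lt_succ_of_le (h.le_of_mem (List.mem_of_mem_drop hx))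
  not_adj := by
    rintro x hx y (hxy | ⟨p, q, hp, -, -⟩)
    · exact h.not_adj_of_mem (List.mem_of_mem_drop hx) hxy
    · exact lt_irrefl _ (lt_of_mem_drop_of_inBlock h.sorted hx hp.inBlock)
  not_marked := by
    rintro x hx (hm | ⟨-, hp⟩)
    · exact h.not_marked_of_mem (List.mem_of_mem_drop hx) hm
    · exact lt_irrefl _ (lt_of_mem_drop_of_inBlock h.sorted hx hp.inBlock)
  uncovered := by
    rintro x y (hxy | ⟨p, q, hp, -, -⟩) t ht hxt hty
    · exact h.not_covered_of_mem hxy (List.mem_of_mem_drop ht) hxt hty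
    · exact lt_asymm hxt (lt_of_mem_drop_of_inBlock h.sorted ht hp.inBlock)
  nonCrossing := by
    rintro a b c d (hab | ⟨p, q, hp, hq, hpq⟩) (hcd | ⟨r, t, hr, ht, hrt⟩) hac hcb hbd
    · exact h.nonCrossing a b c d hab hcd hac hcb hbd
    · exact h.not_covered_of_mem hab hr.mem hac hcb
    · exact h.not_covered_of_mem hcd hq.mem hcb hbd
    · exact PosAt.not_crossing h.sorted hpos hp hq hr ht hpq hrt hac hcb hbd
  coords := by
    classical
    obtain ⟨κ, d, h1, h2, h3, h4⟩ := h.coords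
    set L := n :: s.stack with hL
    have free : ∀ x ∈ L, κ x = x ∧ ∀ y, κ y = x → y = x := by
      intro x hx
      rcases List.mem_cons.1 hx with rfl | hx
      · exact h4 _ (Or.inl le_rfl)
      · exact h4 _ (Or.inr hx)
    obtain ⟨r, hr⟩ := PosAt.exists_of_lt (L := L) hpos (by simpa [hL] using hlen)
      (shape_length_pos pos hpos)
    have hex : ∀ x, ∃ p, InBlock L pos x → PosAt L pos x p := fun x => by
      by_cases hx : InBlock L pos x
      · obtain ⟨p, hp⟩ := hx
        exact ⟨p, fun _ => hp⟩
      · exact ⟨0, fun hx' => absurd hx' hx⟩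
    choose P hP using hex
    have root : ∀ y, κ y = r → InBlock L pos y := fun y hy => by
      rw [(free r hr.mem).2 y hy]
      exact hr.inBlock
    -- The new path is named by its point `r` at position 0. No other point carries this name,
    -- because `r` was not yet on a path.
    refine ⟨fun x => if InBlock L pos x then r else κ x,
      fun x => if InBlock L pos x then P x else d x, ?_, ?_, ?_, ?_⟩
    · intro x y hk hd
      by_cases hx : InBlock L pos x <;> by_cases hy : InBlock L pos y <;>
        simp only [hx, hy, if_true, if_false] at hk hd
      · exact PosAt.point_eq hpos (hP x hx) (hd ▸ hP y hy)
      · exact absurd (root y hk.symm) hy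
      · exact absurd (root x hk) hx
      · exact h1 x y hk hd
    · intro x y
      have old : ∀ x y, InBlock L pos x → ¬s.adj x y :=
        fun x y hx => h.not_adj_of_mem hx.choose_spec.mem
      have old' : ∀ x y, InBlock L pos y → ¬s.adj x y := fun x y hy hxy => old y x hy (h.symm _ _ hxy)
      change (s.adj x y ∨ _) ↔ _
      by_cases hx : InBlock L pos x <;> by_cases hy : InBlock L pos y <;>
        simp only [hx, hy, if_true, if_false]
      · constructor
        · rintro (hxy | ⟨p, q, hp, hq, hpq⟩)
          · exact absurd hxy (old x y hx)
          · rw [PosAt.pos_eq h.sorted (hP x hx) hp, PosAt.pos_eq h.sorted (hP y hy) hq]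
            exact ⟨trivial, hpq⟩
        · rintro ⟨-, hpq⟩
          exact Or.inr ⟨_, _, hP x hx, hP y hy, hpq⟩
      · constructor
        · rintro (hxy | ⟨p, q, hp, hq, hpq⟩)
          · exact absurd hxy (old x y hx)
          · exact absurd hq.inBlock hy
        · rintro ⟨hk, -⟩
          exact absurd (root y hk.symm) hy
      · constructor
        · rintro (hxy | ⟨p, q, hp, hq, hpq⟩)
          · exact absurd hxy (old' x y hy)
          · exact absurd hp.inBlock hx
        · rintro ⟨hk, -⟩
          exact absurd (root x hk) hx
      · rw [← h2]
        constructor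
        · rintro (hxy | ⟨p, q, hp, hq, hpq⟩)
          · exact hxy
          · exact absurd hp.inBlock hx
        · exact Or.inl
    · rintro x (hx | ⟨-, hx⟩)
      · have hx' : ¬InBlock L pos x := fun hx' =>
          h.not_marked_of_mem hx'.choose_spec.mem hx
        simp only [hx', if_false]
        exact h3 x hx
      · have hx' : InBlock L pos x := hx.inBlock
        simp only [hx', if_true]
        exact ⟨PosAt.point_eq hpos hr hx, PosAt.pos_eq h.sorted (hP x hx') hx⟩
    · intro x hx
      have hx' : ¬InBlock L pos x := by
        intro hx'
        rcases hx with hx | hx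
        · have := h.le_of_mem hx'.choose_spec.mem
          omega
        · exact lt_irrefl _ (lt_of_mem_drop_of_inBlock h.sorted hx hx')
      have hfree := h4 x (by
        rcases hx with hx | hx
        · exact Or.inl (by omega)
        · rcases List.mem_cons.1 (List.mem_of_mem_drop hx) with rfl | hx
          · exact Or.inl le_rfl
          · exact Or.inr hx)
      simp only [hx', if_false]
      refine ⟨hfree.1, fun y => ?_⟩
      by_cases hy : InBlock L pos y <;> simp only [hy, if_true, if_false]
      · rintro rfl
        exact absurd hr.inBlock hx'
      · exact hfree.2 y

theorem noFreeSingleton_close (hs : NoFreeSingleton n s)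
    (hpos : pos ∈ orientedPathShapes) (hlen : pos.length ≤ s.stack.length + 1)
    (hm : pos.length = 1 → m = true) : NoFreeSingleton (n + 1) (s.close n pos m) := by
  intro x hx hxs
  have hlen' : pos.length ≤ (n :: s.stack).length := by simpa using hlen
  by_cases hb : InBlock (n :: s.stack) pos x
  · obtain ⟨p, hp⟩ := hb
    have hpl := hp.lt_length hpos
    rcases Nat.eq_zero_or_pos p with rfl | hp0
    · by_cases h1 : pos.length = 1
      · exact Or.inl (Or.inr ⟨hm h1, hp⟩)
      · obtain ⟨y, hy⟩ := PosAt.exists_of_lt (L := n :: s.stack) (p := 1) hpos hlen' (by omega)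
        exact Or.inr ⟨y, Or.inr ⟨_, _, hp, hy, Or.inl rfl⟩⟩
    · obtain ⟨y, hy⟩ := PosAt.exists_of_lt (L := n :: s.stack) (p := p - 1) hpos hlen' (by omega)
      exact Or.inr ⟨y, Or.inr ⟨_, _, hp, hy, Or.inr (by omega)⟩⟩
  · have hxL : x ∉ n :: s.stack := fun hxL => by
      rcases inBlock_or_mem_drop.1 hxL with h' | h'
      · exact hb h'
      · exact hxs h'
    have hxn : x ≠ n ∧ x ∉ s.stack := by simpa using hxL
    rcases hs x (by omega) hxn.2 with h' | ⟨y, hy⟩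
    · exact Or.inl (Or.inl h')
    · exact Or.inr ⟨y, Or.inl hy⟩

end PartialPaths

/-! ### Recovering the last step of the scan. -/

namespace PartialPaths

variable {n : ℕ} {s s' : PartialPaths} {pos pos' : List ℕ} {m m' : Bool}

/-- The ways to form a path: its shape, and whether its first point is marked. -/
def closings : Finset (List ℕ × Bool) :=
  orientedPathShapes ×ˢ {true} ∪ pathShapes ×ˢ {false}

theorem closings_spec : ∀ a ∈ closings, a.1 ∈ orientedPathShapes ∧
    (a.2 = false → a.1 ∈ pathShapes) := by decide +kernel

theorem close_adj_iff (h : IsGood n s) {x y p q : ℕ} (hx : PosAt (n :: s.stack) pos x p)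
    (hy : PosAt (n :: s.stack) pos y q) : (s.close n pos m).adj x y ↔ Consecutive p q := by
  constructor
  · rintro (hxy | ⟨p', q', hp, hq, hpq⟩)
    · exact absurd hxy (h.not_adj_of_mem hx.mem)
    · rwa [PosAt.pos_eq h.sorted hx hp, PosAt.pos_eq h.sorted hy hq]
  · exact fun hpq => Or.inr ⟨p, q, hx, hy, hpq⟩

theorem close_marked_iff (h : IsGood n s) {x p : ℕ} (hx : PosAt (n :: s.stack) pos x p) :
    (s.close n pos m).marked x ↔ m = true ∧ p = 0 := by
  constructor
  · rintro (hm | ⟨hm, h0⟩)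
    · exact absurd hm (h.not_marked_of_mem hx.mem)
    · exact ⟨hm, PosAt.pos_eq h.sorted hx h0⟩
  · rintro ⟨hm, rfl⟩
    exact Or.inr ⟨hm, hx⟩

/-- Deleting the edges of the last path restores the old family; this is how a scan is undone. -/
theorem adj_iff_close (h : IsGood n s) {x y : ℕ} :
    s.adj x y ↔ (s.close n pos m).adj x y ∧ ¬InBlock (n :: s.stack) pos x := by
  constructor
  · exact fun hxy => ⟨Or.inl hxy, fun hx => h.not_adj_of_mem hx.choose_spec.mem hxy⟩
  · rintro ⟨hxy | ⟨p, q, hp, -, -⟩, hx⟩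
    · exact hxy
    · exact absurd hp.inBlock hx

theorem marked_iff_close (h : IsGood n s) {x : ℕ} :
    s.marked x ↔ (s.close n pos m).marked x ∧ ¬InBlock (n :: s.stack) pos x := by
  constructor
  · exact fun hxy => ⟨Or.inl hxy, fun hx => h.not_marked_of_mem hx.choose_spec.mem hxy⟩
  · rintro ⟨hxy | ⟨-, hp⟩, hx⟩
    · exact hxy
    · exact absurd hp.inBlock hx

/-- The last path is the component of `n`. Starting from `n`, the edges of one block cannot leave
the other, since its points had no edges before the step. -/
theorem inBlock_of_close_eq (h : IsGood n s) (hpos : pos ∈ orientedPathShapes)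
    (hpos' : pos' ∈ orientedPathShapes) (hlen' : pos'.length ≤ s'.stack.length + 1)
    (heq : s.close n pos m = s'.close n pos' m') {x : ℕ}
    (hx : InBlock (n :: s'.stack) pos' x) : InBlock (n :: s.stack) pos x := by
  obtain ⟨p, hp⟩ := hx
  obtain ⟨q, hq⟩ := inBlock_self hpos' s'.stack n
  refine PosAt.mem_of_closed hpos' (by simpa using hlen') ?_ hq (inBlock_self hpos s.stack n) hp
  rintro x y p q hp hq hpq ⟨r, hr⟩
  have : (s.close n pos m).adj x y := by
    rw [heq]
    exact Or.inr ⟨p, q, hp, hq, hpq⟩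
  rcases this with hxy | ⟨-, q', -, hq', -⟩
  · exact absurd hxy (h.not_adj_of_mem hr.mem)
  · exact hq'.inBlock

/-- The last path can be read off from the family. -/
theorem close_injective (h : IsGood n s) (h' : IsGood n s') (ha : (pos, m) ∈ closings)
    (ha' : (pos', m') ∈ closings) (hlen : pos.length ≤ s.stack.length + 1)
    (hlen' : pos'.length ≤ s'.stack.length + 1)
    (heq : s.close n pos m = s'.close n pos' m') : s = s' ∧ pos = pos' ∧ m = m' := by
  obtain ⟨hpos, hm⟩ := closings_spec _ ha
  obtain ⟨hpos', hm'⟩ := closings_spec _ ha'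
  dsimp only at hpos hm hpos' hm'
  have hblock : ∀ x, InBlock (n :: s.stack) pos x ↔ InBlock (n :: s'.stack) pos' x := fun x =>
    ⟨inBlock_of_close_eq h' hpos' hpos hlen heq.symm, inBlock_of_close_eq h hpos hpos' hlen' heq⟩
  have htake : (n :: s.stack).take pos.length = (n :: s'.stack).take pos'.length := by
    refine List.Pairwise.eq_of_mem_iff (r := (· > ·)) (h.sorted.sublist (List.take_sublist _ _))
      (h'.sorted.sublist (List.take_sublist _ _)) fun x => ?_
    rw [← inBlock_iff_mem_take, ← inBlock_iff_mem_take]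
    exact hblock x
  have hdrop : (n :: s.stack).drop pos.length = (n :: s'.stack).drop pos'.length :=
    congrArg PartialPaths.stack heq
  have hstack : s.stack = s'.stack := by
    have : n :: s.stack = n :: s'.stack := by
      rw [← List.take_append_drop pos.length (n :: s.stack), htake, hdrop,
        List.take_append_drop]
    exact List.tail_eq_of_cons_eq this
  have hlength : pos.length = pos'.length := by
    have := congrArg List.length htake
    simp only [List.length_take, List.length_cons] at this
    omega
  have hs : s = s' := by
    ext x y
    · rw [adj_iff_close h (pos := pos) (m := m), adj_iff_close h' (pos := pos') (m := m'), heq,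
        hblock]
    · rw [marked_iff_close h (pos := pos) (m := m), marked_iff_close h' (pos := pos') (m := m'),
        heq, hblock]
    · rw [hstack]
  subst hs
  have hat : ∀ pos : List ℕ, pos.length ≤ s.stack.length + 1 → ∀ i (hi : i < pos.length)
      (hi' : i < (n :: s.stack).length), PosAt (n :: s.stack) pos (n :: s.stack)[i]
        (pos.getD i 0) := fun pos hl i hi hi' =>
    ⟨i, List.getElem?_eq_getElem hi', by simp [hi]⟩
  have hlt : ∀ i < pos.length, i < (n :: s.stack).length := fun i hi =>
    hi.trans_le (by simpa using hlen)
  have hcons : ∀ i < pos.length, ∀ j < pos.length,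
      Consecutive (pos.getD i 0) (pos.getD j 0) ↔
        Consecutive (pos'.getD i 0) (pos'.getD j 0) := by
    intro i hi j hj
    rw [← close_adj_iff h (m := m) (hat pos hlen i hi (hlt i hi)) (hat pos hlen j hj (hlt j hj)),
      heq, close_adj_iff h (hat pos' hlen' i (hlength ▸ hi) (hlt i hi))
        (hat pos' hlen' j (hlength ▸ hj) (hlt j hj))]
  have hmark : ∀ i < pos.length, (m = true ∧ pos.getD i 0 = 0) ↔
      (m' = true ∧ pos'.getD i 0 = 0) := by
    intro i hi
    rw [← close_marked_iff h (hat pos hlen i hi (hlt i hi)), heq,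
      close_marked_iff h (hat pos' hlen' i (hlength ▸ hi) (hlt i hi))]
  have hroot : ∀ pos ∈ orientedPathShapes, ∃ i < pos.length, pos.getD i 0 = 0 := by
    intro pos hpos
    obtain ⟨i, hi, hi0⟩ := List.mem_iff_getElem.1
      ((shape_mem_iff pos hpos 0).2 (shape_length_pos pos hpos))
    exact ⟨i, hi, by simp [hi, hi0]⟩
  have hmm : m = m' := by
    rw [Bool.eq_iff_iff]
    constructor
    · intro hm
      obtain ⟨i, hi, hi0⟩ := hroot pos hpos
      exact ((hmark i hi).1 ⟨hm, hi0⟩).1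
    · intro hm
      obtain ⟨i, hi, hi0⟩ := hroot pos' hpos'
      exact ((hmark i (hlength ▸ hi)).2 ⟨hm, hi0⟩).1
  subst hmm
  refine ⟨rfl, ?_, rfl⟩
  cases m with
  | false => exact shape_ext pos (hm rfl) pos' (hm' rfl) hlength hcons
  | true => exact shape_ext_of_root pos hpos pos' hpos' hlength hcons (by simpa using hmark)

/-- Process the new point `n`: put it on the stack, or form a path. -/
def step (n : ℕ) : Option (List ℕ × Bool) → PartialPaths → PartialPaths
  | none, s => s.push n
  | some a, s => s.close n a.1 a.2

/-- There are enough points on the stack. -/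
def CanStep : Option (List ℕ × Bool) → PartialPaths → Prop
  | none, _ => True
  | some a, s => a.1.length ≤ s.stack.length + 1

theorem isGood_step (h : IsGood n s) {A : Finset (List ℕ × Bool)} (hA : A ⊆ closings)
    {a : Option (List ℕ × Bool)} (ha : a ∈ A.insertNone) (hs : CanStep a s) :
    IsGood (n + 1) (step n a s) := by
  cases a with
  | none => exact isGood_push h
  | some a => exact isGood_close h (closings_spec _ (hA (Finset.some_mem_insertNone.1 ha))).1 hs

/-- The two kinds of step differ in whether `n` is on the stack afterwards. -/
theorem push_ne_close (h' : IsGood n s') (hpos : pos ∈ orientedPathShapes) :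
    s.push n ≠ s'.close n pos m := by
  intro heq
  have h1 : n ∈ (n :: s'.stack).drop pos.length := by
    have : n :: s.stack = (n :: s'.stack).drop pos.length := congrArg PartialPaths.stack heq
    rw [← this]
    exact List.mem_cons_self
  exact lt_irrefl _ (lt_of_mem_drop_of_inBlock h'.sorted h1 (inBlock_self hpos _ n))

theorem step_injective (h : IsGood n s) (h' : IsGood n s') {A : Finset (List ℕ × Bool)}
    (hA : A ⊆ closings) {a a' : Option (List ℕ × Bool)} (ha : a ∈ A.insertNone)
    (ha' : a' ∈ A.insertNone) (hs : CanStep a s) (hs' : CanStep a' s')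
    (heq : step n a s = step n a' s') : s = s' ∧ a = a' := by
  rcases a with - | ⟨pos, m⟩ <;> rcases a' with - | ⟨pos', m'⟩
  · have h1 : (s.push n).adj = (s'.push n).adj := congrArg PartialPaths.adj heq
    have h2 : (s.push n).marked = (s'.push n).marked := congrArg PartialPaths.marked heq
    refine ⟨?_, rfl⟩
    ext x y
    · exact iff_of_eq (congrFun (congrFun h1 x) y)
    · exact iff_of_eq (congrFun h2 x)
    · have : n :: s.stack = n :: s'.stack := congrArg PartialPaths.stack heq
      rw [List.tail_eq_of_cons_eq this]
  · exact absurd heq (push_ne_close h'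
      (closings_spec _ (hA (Finset.some_mem_insertNone.1 ha'))).1)
  · exact absurd heq.symm (push_ne_close h
      (closings_spec _ (hA (Finset.some_mem_insertNone.1 ha))).1)
  · obtain ⟨h1, rfl, rfl⟩ := close_injective h h' (hA (Finset.some_mem_insertNone.1 ha))
      (hA (Finset.some_mem_insertNone.1 ha')) hs hs' heq
    exact ⟨h1, rfl⟩

/-! ### Counting the families by the height of the stack. -/

open Classical in
/-- The families that arise from the first `n` points. -/
noncomputable def families (A : Finset (List ℕ × Bool)) : ℕ → Finset PartialPaths
  | 0 => {empty}
  | n + 1 => ((families A n ×ˢ A.insertNone).filter fun q => CanStep q.2 q.1).image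
      fun q => step n q.2 q.1

variable {A : Finset (List ℕ × Bool)}

theorem mem_families_succ {t : PartialPaths} :
    t ∈ families A (n + 1) ↔
      ∃ s ∈ families A n, ∃ a ∈ A.insertNone, CanStep a s ∧ step n a s = t := by
  classical
  rw [families]
  simp only [Finset.mem_image, Finset.mem_filter, Finset.mem_product, Prod.exists]
  constructor
  · rintro ⟨s, a, ⟨⟨hs, ha⟩, hc⟩, h⟩
    exact ⟨s, hs, a, ha, hc, h⟩
  · rintro ⟨s, hs, a, ha, hc, h⟩
    exact ⟨s, a, ⟨⟨hs, ha⟩, hc⟩, h⟩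

theorem isGood_of_mem (hA : A ⊆ closings) : ∀ n, ∀ s ∈ families A n, IsGood n s := by
  intro n
  induction n with
  | zero =>
    intro s hs
    rw [families, Finset.mem_singleton] at hs
    exact hs ▸ isGood_empty
  | succ n ih =>
    intro t ht
    obtain ⟨s, hs, a, ha, hc, rfl⟩ := mem_families_succ.1 ht
    exact isGood_step (ih s hs) hA ha hc

theorem noFreeSingleton_of_mem (hA : A ⊆ closings) (hA' : ([0], false) ∉ A) :
    ∀ n, ∀ s ∈ families A n, NoFreeSingleton n s := by
  intro n
  induction n with
  | zero => exact fun s hs x hx => absurd hx (Nat.not_lt_zero x)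
  | succ n ih =>
    intro t ht
    obtain ⟨s, hs, a, ha, hc, rfl⟩ := mem_families_succ.1 ht
    rcases a with - | ⟨pos, m⟩
    · exact noFreeSingleton_push (ih s hs)
    · rw [Finset.some_mem_insertNone] at ha
      have hpos := (closings_spec _ (hA ha)).1
      refine noFreeSingleton_close (ih s hs) hpos hc fun h1 => ?_
      have : pos = [0] := by
        obtain ⟨p, rfl⟩ := List.length_eq_one_iff.1 h1
        have := (shape_mem_iff _ hpos p).1 (by simp)
        simp only [List.length_cons, List.length_nil] at this
        rw [show p = 0 by omega]
      subst this
      cases m with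
      | true => rfl
      | false => exact absurd ha hA'

theorem step_injOn (hA : A ⊆ closings) (n : ℕ) [DecidablePred fun q : PartialPaths ×
    Option (List ℕ × Bool) => CanStep q.2 q.1] :
    Set.InjOn (fun q : PartialPaths × Option (List ℕ × Bool) => step n q.2 q.1)
      ((families A n ×ˢ A.insertNone).filter fun q => CanStep q.2 q.1) := by
  rintro ⟨s, a⟩ hq ⟨s', a'⟩ hq' heq
  simp only [Finset.coe_filter, Finset.mem_product, Set.mem_ofPred_eq] at hq hq'
  obtain ⟨h1, h2⟩ := step_injective (isGood_of_mem hA n s hq.1.1) (isGood_of_mem hA n s' hq'.1.1)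
    hA hq.1.2 hq'.1.2 hq.2 hq'.2 heq
  rw [h1, h2]

/-- The sum of a weight of the height of the stack over all families, by the last step. -/
theorem sum_families_succ (hA : A ⊆ closings) (n : ℕ) (v : ℕ → ℕ) :
    ∑ t ∈ families A (n + 1), v t.stack.length =
      ∑ s ∈ families A n, (v (s.stack.length + 1) + ∑ a ∈ A,
        if a.1.length ≤ s.stack.length + 1 then v (s.stack.length + 1 - a.1.length) else 0) := by
  classical
  -- Injectivity of the steps turns the sum over results into a sum over pairs of a family and a
  -- step.
  rw [families, Finset.sum_image (step_injOn hA n), Finset.sum_filter, Finset.sum_product]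
  refine Finset.sum_congr rfl fun s _ => ?_
  rw [Finset.sum_insertNone]
  congr 1
  · simp [CanStep, step, push]
  · refine Finset.sum_congr rfl fun a _ => ?_
    simp [CanStep, step, close]

/-- A sub-eigenvector of the height statistics bounds the growth of the families from below. -/
theorem pow_le_sum_families (hA : A ⊆ closings) (v : ℕ → ℕ) (p q : ℕ)
    (hv : ∀ h, p * v h ≤ q * (v (h + 1) + ∑ a ∈ A,
      if a.1.length ≤ h + 1 then v (h + 1 - a.1.length) else 0)) (n : ℕ) :
    p ^ n * v 0 ≤ q ^ n * ∑ s ∈ families A n, v s.stack.length := by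
  induction n with
  | zero => simp [families, empty]
  | succ n ih =>
    rw [sum_families_succ hA]
    calc p ^ (n + 1) * v 0 = p * (p ^ n * v 0) := by ring
      _ ≤ p * (q ^ n * ∑ s ∈ families A n, v s.stack.length) := Nat.mul_le_mul_left _ ih
      _ = q ^ n * ∑ s ∈ families A n, p * v s.stack.length := by rw [← Finset.mul_sum]; ring
      _ ≤ q ^ n * ∑ s ∈ families A n, q * _ :=
        Nat.mul_le_mul_left _ (Finset.sum_le_sum fun s _ => hv s.stack.length)
      _ = _ := by rw [← Finset.mul_sum]; ring

open Classical in
/-- The families with `h` points on the stack. -/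
noncomputable def familiesAt (A : Finset (List ℕ × Bool)) (n h : ℕ) : Finset PartialPaths :=
  (families A n).filter fun s => s.stack.length = h

/-- Performing one fixed closing as the next step is injective. -/
theorem card_familiesAt_le (hA : A ⊆ closings) {a : List ℕ × Bool} (ha : a ∈ A) {h h' : ℕ}
    (hh : h' + a.1.length = h + 1) (n : ℕ) :
    (familiesAt A n h).card ≤ (familiesAt A (n + 1) h').card := by
  have ha' : some a ∈ A.insertNone := Finset.some_mem_insertNone.2 ha
  have hc : ∀ s ∈ familiesAt A n h, s ∈ families A n ∧ s.stack.length = h := fun s hs => by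
    simpa [familiesAt] using hs
  have hcan : ∀ s ∈ familiesAt A n h, CanStep (some a) s := fun s hs => by
    have := (hc s hs).2
    simp only [CanStep]
    omega
  refine Finset.card_le_card_of_injOn (step n (some a)) ?_ ?_
  · intro s hs
    have hs := Finset.mem_coe.1 hs
    refine Finset.mem_coe.2 (Finset.mem_filter.2 ⟨mem_families_succ.2
      ⟨s, (hc s hs).1, _, ha', hcan s hs, rfl⟩, ?_⟩)
    have := (hc s hs).2
    simp only [step, close, List.length_drop, List.length_cons]
    omega
  · intro s hs s' hs' heq
    have hs := Finset.mem_coe.1 hs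
    have hs' := Finset.mem_coe.1 hs'
    exact (step_injective (isGood_of_mem hA n s (hc s hs).1) (isGood_of_mem hA n s' (hc s' hs').1)
      hA ha' ha' (hcan s hs) (hcan s' hs') heq).1

/-- Exactly `k` further points empty a stack of height at most `k`: each one is paired with the top
of the stack, or becomes a marked single point once the stack is empty. Both closings remain
available when unmarked single points are forbidden. -/
theorem card_familiesAt_le_zero (hA : A ⊆ closings) (h1 : ([0], true) ∈ A)
    (h2 : ([0, 1], true) ∈ A) (k : ℕ) : ∀ n h, h ≤ k →
    (familiesAt A n h).card ≤ (familiesAt A (n + k) 0).card := by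
  induction k with
  | zero =>
    intro n h hh
    rw [Nat.le_zero.1 hh]
    exact le_rfl
  | succ k ih =>
    intro n h hh
    rw [show n + (k + 1) = n + 1 + k by ring]
    rcases h with - | h
    · exact (card_familiesAt_le hA h1 rfl n).trans (ih _ _ (Nat.zero_le _))
    · exact (card_familiesAt_le hA h2 rfl n).trans (ih _ _ (by omega))

/-- An approximate eigenvector of the height statistics, for heights up to 9. -/
def heightWeight (h : ℕ) : ℕ :=
  [10, 52, 241, 1011, 3836, 13527, 44067, 130197, 332284, 619272].getD h 0

theorem heightWeight_eq_zero {h : ℕ} (hh : 9 < h) : heightWeight h = 0 := by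
  unfold heightWeight
  exact List.getD_eq_default _ _ hh

theorem heightWeight_le (h : ℕ) : heightWeight h ≤ 619272 := by
  rcases lt_or_ge 9 h with hh | hh
  · rw [heightWeight_eq_zero hh]
    exact Nat.zero_le _
  · revert h
    decide

/-- If the height statistics with the weight `heightWeight` grow by a factor of `p / q` with each
point, then so does the number of families with empty stack. -/
theorem pow_le_card_familiesAt (hA : A ⊆ closings) (h1 : ([0], true) ∈ A)
    (h2 : ([0, 1], true) ∈ A) (p q : ℕ)
    (hv : ∀ h ≤ 9, p * heightWeight h ≤ q * (heightWeight (h + 1) + ∑ a ∈ A,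
      if a.1.length ≤ h + 1 then heightWeight (h + 1 - a.1.length) else 0)) (n : ℕ) :
    p ^ n ≤ q ^ n * (619272 * (familiesAt A (n + 9) 0).card) := by
  classical
  -- Above height 9 the weight vanishes and the inequality is trivial, which leaves ten numerical
  -- inequalities.
  have key := pow_le_sum_families hA heightWeight p q (fun h => by
    rcases lt_or_ge 9 h with hh | hh
    · rw [heightWeight_eq_zero hh, mul_zero]
      exact Nat.zero_le _
    · exact hv h hh) n
  have hsum : ∑ s ∈ families A n, heightWeight s.stack.length
      ≤ 619272 * (10 * (familiesAt A (n + 9) 0).card) := by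
    calc ∑ s ∈ families A n, heightWeight s.stack.length
        = ∑ s ∈ (families A n).filter (fun s => s.stack.length ∈ Finset.range 10),
            heightWeight s.stack.length := by
          rw [Finset.sum_filter_of_ne]
          intro s _ hs
          by_contra hn
          exact hs (heightWeight_eq_zero (by rw [Finset.mem_range] at hn; omega))
      _ ≤ ∑ s ∈ (families A n).filter (fun s => s.stack.length ∈ Finset.range 10), 619272 :=
          Finset.sum_le_sum fun s _ => heightWeight_le _
      _ = 619272 * ((families A n).filter (fun s => s.stack.length ∈ Finset.range 10)).card := by
          rw [Finset.sum_const, smul_eq_mul, mul_comm]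
      _ ≤ 619272 * (10 * (familiesAt A (n + 9) 0).card) := by
          refine Nat.mul_le_mul_left _ ?_
          rw [Finset.card_eq_sum_card_fiberwise (s := (families A n).filter
            (fun s => s.stack.length ∈ Finset.range 10)) (f := fun s => s.stack.length)
            (t := Finset.range 10) (fun s hs => (Finset.mem_filter.1 (Finset.mem_coe.1 hs)).2)]
          calc _ ≤ ∑ h ∈ Finset.range 10, (familiesAt A (n + 9) 0).card := by
                refine Finset.sum_le_sum fun h hh => ?_
                refine le_trans (Finset.card_le_card ?_)
                  (card_familiesAt_le_zero hA h1 h2 9 n h (by simp at hh; omega))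
                intro s hs
                simp only [Finset.mem_filter] at hs
                exact Finset.mem_filter.2 ⟨hs.1.1, hs.2⟩
            _ = _ := by simp
  -- The weight 10 at height 0 cancels the factor 10 from the ten heights.
  have h0 : heightWeight 0 = 10 := rfl
  rw [h0] at key
  have := key.trans (Nat.mul_le_mul_left (q ^ n) hsum)
  nlinarith

/-- One to four points in convex position have 1, 1, 3, 8 non-crossing spanning paths. Each can be
unmarked or have either of its ends marked, the ends coinciding for a single point: 1 + 1, 1 + 2, 3
+ 6, 8 + 16. -/
theorem sum_closings (g : ℕ → ℕ) :
    ∑ a ∈ closings, g a.1.length = 2 * g 1 + 3 * g 2 + 9 * g 3 + 24 * g 4 := by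
  rw [Finset.sum_comp g fun a : List ℕ × Bool => a.1.length,
    show closings.image (fun a => a.1.length) = {1, 2, 3, 4} by decide +kernel]
  have h1 : (closings.filter fun a => a.1.length = 1).card = 2 := by decide +kernel
  have h2 : (closings.filter fun a => a.1.length = 2).card = 3 := by decide +kernel
  have h3 : (closings.filter fun a => a.1.length = 3).card = 9 := by decide +kernel
  have h4 : (closings.filter fun a => a.1.length = 4).card = 24 := by decide +kernel
  simp [h1, h2, h3, h4]
  ring

/-- The ways to form a path that is not an unmarked point. -/
def closingsWS : Finset (List ℕ × Bool) := closings.erase ([0], false)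

theorem sum_closingsWS (g : ℕ → ℕ) :
    ∑ a ∈ closingsWS, g a.1.length = g 1 + 3 * g 2 + 9 * g 3 + 24 * g 4 := by
  have h := Finset.add_sum_erase closings (fun a => g a.1.length)
    (show ([0], false) ∈ closings by decide +kernel)
  rw [sum_closings] at h
  simp only [List.length_cons, List.length_nil, zero_add] at h
  unfold closingsWS
  omega

theorem pow_le_card_closings (n : ℕ) :
    36 ^ n ≤ 5 ^ n * (619272 * (familiesAt closings (n + 9) 0).card) := by
  refine pow_le_card_familiesAt subset_rfl (by decide +kernel) (by decide +kernel) 36 5 ?_ n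
  intro h hh
  rw [sum_closings fun l => if l ≤ h + 1 then heightWeight (h + 1 - l) else 0]
  revert h
  decide +kernel

/-- Dropping the unmarked single point removes one copy of the weight at the same height, so the
same weights give the rate 36/5 - 1. -/
theorem pow_le_card_closingsWS (n : ℕ) :
    31 ^ n ≤ 5 ^ n * (619272 * (familiesAt closingsWS (n + 9) 0).card) := by
  refine pow_le_card_familiesAt (A := closingsWS) (Finset.erase_subset _ _) (by decide +kernel)
    (by decide +kernel) 31 5 ?_ n
  intro h hh
  rw [sum_closingsWS fun l => if l ≤ h + 1 then heightWeight (h + 1 - l) else 0]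
  revert h
  decide +kernel

end PartialPaths

/-! ### Joining the families on the two chains at marks of equal rank. -/

open Classical in
/-- The number of points before `x` that satisfy `p`. -/
noncomputable def rankBelow (p : ℕ → Prop) (x : ℕ) : ℕ := Nat.count p x

theorem rankBelow_lt_rankBelow {p : ℕ → Prop} {x y : ℕ} (hx : p x) (hxy : x < y) :
    rankBelow p x < rankBelow p y := by
  classical
  exact Nat.count_strict_mono hx hxy

theorem rankBelow_inj {p : ℕ → Prop} {x y : ℕ} (hx : p x) (hy : p y)
    (h : rankBelow p x = rankBelow p y) : x = y := by
  rcases lt_trichotomy x y with hxy | hxy | hxy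
  · exact absurd h (rankBelow_lt_rankBelow hx hxy).ne
  · exact hxy
  · exact absurd h (rankBelow_lt_rankBelow hy hxy).ne'

theorem rankBelow_le (p : ℕ → Prop) (x : ℕ) : rankBelow p x ≤ x := by
  classical
  exact Nat.count_le p

theorem exists_rankBelow_eq {p : ℕ → Prop} {r n : ℕ} (h : r < rankBelow p n) :
    ∃ x < n, p x ∧ rankBelow p x = r := by
  classical
  induction n with
  | zero => simp [rankBelow] at h
  | succ n ih =>
    by_cases hr : r < rankBelow p n
    · obtain ⟨x, hx, h'⟩ := ih hr
      exact ⟨x, by omega, h'⟩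
    · unfold rankBelow at h hr ⊢
      rw [Nat.count_succ] at h
      split_ifs at h with hp
      · exact ⟨n, by omega, hp, by omega⟩
      · omega

namespace PartialPaths

/-- The edges of the graph that arises from families of paths on both chains by joining the
`i`-th marked point above to the `i`-th marked point below, for all `i`. -/
def JoinAdj {n : ℕ} (s t : PartialPaths) : Fin n ⊕ Fin n → Fin n ⊕ Fin n → Prop
  | .inl a, .inl b => s.adj a b
  | .inr a, .inr b => t.adj a b
  | .inl a, .inr b => s.marked a ∧ t.marked b ∧ rankBelow s.marked a = rankBelow t.marked b
  | .inr b, .inl a => s.marked a ∧ t.marked b ∧ rankBelow s.marked a = rankBelow t.marked b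

variable {n : ℕ} {s t : PartialPaths}

theorem IsGood.adj_irrefl (h : IsGood n s) (x : ℕ) : ¬s.adj x x := by
  obtain ⟨κ, d, -, h2, -⟩ := h.coords
  rw [h2]
  unfold Consecutive
  omega

/-- The graph with the edges `JoinAdj`. -/
def join (n : ℕ) (s t : PartialPaths) : SimpleGraph (Fin n ⊕ Fin n) :=
  SimpleGraph.fromRel (JoinAdj s t)

theorem join_adj (hs : IsGood n s) (ht : IsGood n t) (x y : Fin n ⊕ Fin n) :
    (join n s t).Adj x y ↔ JoinAdj s t x y := by
  rw [join, SimpleGraph.fromRel_adj]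
  have symm : JoinAdj s t y x → JoinAdj s t x y := by
    rcases x with x | x <;> rcases y with y | y
    · exact hs.symm _ _
    · exact id
    · exact id
    · exact ht.symm _ _
  constructor
  · rintro ⟨-, h | h⟩
    · exact h
    · exact symm h
  · refine fun h => ⟨?_, Or.inl h⟩
    rintro rfl
    rcases x with x | x
    · exact hs.adj_irrefl _ h
    · exact ht.adj_irrefl _ h

/-- The rank is strictly increasing on marked points, so joining equal ranks gives an
order-preserving matching. -/
theorem isOrderNonCrossing_join (hs : IsGood n s) (ht : IsGood n t) :
    IsOrderNonCrossing (join n s t) where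
  upper a b c d hab hcd := by
    rw [join_adj hs ht] at hab hcd
    exact hs.nonCrossing _ _ _ _ hab hcd
  lower a b c d hab hcd := by
    rw [join_adj hs ht] at hab hcd
    exact ht.nonCrossing _ _ _ _ hab hcd
  cross a b c d hab hcd := by
    rw [join_adj hs ht] at hab hcd
    obtain ⟨ha, hb, hab⟩ := hab
    obtain ⟨hc, hd, hcd⟩ := hcd
    have lower : rankBelow t.marked b < rankBelow t.marked d → b < d := fun h => by
      by_contra hn
      rcases (not_lt.1 hn).eq_or_lt with h' | h'
      · rw [h'] at h
        exact lt_irrefl _ h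
      · exact lt_asymm h (rankBelow_lt_rankBelow hd h')
    have lower' : rankBelow t.marked d < rankBelow t.marked b → d < b := fun h => by
      by_contra hn
      rcases (not_lt.1 hn).eq_or_lt with h' | h'
      · rw [h'] at h
        exact lt_irrefl _ h
      · exact lt_asymm h (rankBelow_lt_rankBelow hb h')
    rcases lt_trichotomy a c with h | rfl | h
    · have := rankBelow_lt_rankBelow ha (Fin.lt_def.1 h)
      exact Or.inl ⟨h, lower (by omega)⟩
    · exact Or.inr (Or.inr ⟨rfl, Fin.ext (rankBelow_inj hb hd (by omega))⟩)
    · have := rankBelow_lt_rankBelow hc (Fin.lt_def.1 h)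
      exact Or.inr (Or.inl ⟨h, lower' (by omega)⟩)

theorem isOrderNCP_join (hs : IsGood n s) (ht : IsGood n t) : IsOrderNCP (join n s t) where
  nonCrossing := isOrderNonCrossing_join hs ht
  coords := by
    classical
    obtain ⟨κ, d, inj, adj, mark, -⟩ := hs.coords
    obtain ⟨κ', d', inj', adj', mark', -⟩ := ht.coords
    -- the marked paths are labelled by their rank, the other ones by their side and first point
    let label : Fin n ⊕ Fin n → ℕ ⊕ (ℕ ⊕ ℕ) := Sum.elim
      (fun x => if s.marked (κ x) then .inl (rankBelow s.marked (κ x)) else .inr (.inl (κ x)))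
      (fun x => if t.marked (κ' x) then .inl (rankBelow t.marked (κ' x)) else .inr (.inr (κ' x)))
    -- A marked lower path is reversed onto -1, -2, ..., so that its marked end at -1 is next to the
    -- marked end at 0 of its upper partner. A marked path without a partner does no harm.
    let coord : Fin n ⊕ Fin n → ℤ := Sum.elim (fun x => (d x : ℤ))
      (fun x => if t.marked (κ' x) then -1 - (d' x : ℤ) else d' x)
    have labelX : ∀ x y : Fin n, label (.inl x) = label (.inl y) ↔ κ x = κ y := by
      intro x y
      simp only [label, Sum.elim_inl]
      constructor
      · intro h
        split_ifs at h with h1 h2 h2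
        · exact rankBelow_inj h1 h2 (Sum.inl.inj h)
        · exact Sum.inl.inj (Sum.inr.inj h)
      · intro h
        rw [h]
    have labelY : ∀ x y : Fin n, label (.inr x) = label (.inr y) ↔ κ' x = κ' y := by
      intro x y
      simp only [label, Sum.elim_inr]
      constructor
      · intro h
        split_ifs at h with h1 h2 h2
        · exact rankBelow_inj h1 h2 (Sum.inl.inj h)
        · exact Sum.inr.inj (Sum.inr.inj h)
      · intro h
        rw [h]
    have labelXY : ∀ x y : Fin n, label (.inl x) = label (.inr y) ↔ s.marked (κ x) ∧
        t.marked (κ' y) ∧ rankBelow s.marked (κ x) = rankBelow t.marked (κ' y) := by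
      intro x y
      simp only [label, Sum.elim_inl, Sum.elim_inr]
      split_ifs with h1 h2 h2 <;> simp [h1, h2]
    have coordY : ∀ x y : Fin n, κ' x = κ' y →
        |coord (.inr x) - coord (.inr y)| = |(d' x : ℤ) - d' y| := by
      intro x y h
      simp only [coord, Sum.elim_inr, h]
      split_ifs
      · rw [abs_sub_comm]
        congr 1
        ring
      · rfl
    have adjXY : ∀ x y : Fin n, JoinAdj s t (.inl x) (.inr y) ↔
        label (.inl x) = label (.inr y) ∧ |coord (.inl x) - coord (.inr y)| = 1 := by
      intro x y
      rw [labelXY]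
      constructor
      · rintro ⟨hx, hy, hxy⟩
        have h1 := mark x hx
        have h2 := mark' y hy
        rw [h1.1, h2.1]
        refine ⟨⟨hx, hy, hxy⟩, ?_⟩
        simp [coord, h1.2, h2.1, h2.2, hy]
      · rintro ⟨⟨hx, hy, hxy⟩, hd⟩
        simp only [coord, Sum.elim_inl, Sum.elim_inr, hy, if_true] at hd
        rw [abs_eq (by norm_num)] at hd
        have h1 := mark _ hx
        have h2 := mark' _ hy
        have e1 : κ x = x := inj _ _ h1.1 (by omega)
        have e2 : κ' y = y := inj' _ _ h2.1 (by omega)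
        rw [e1] at hx hxy
        rw [e2] at hy hxy
        exact ⟨hx, hy, hxy⟩
    refine ⟨_, label, coord, ?_, ?_⟩
    · rintro (x | x) (y | y) hl hc
      · rw [labelX] at hl
        exact congrArg _ (Fin.ext (inj _ _ hl (by simpa [coord] using hc)))
      · have hy := ((labelXY x y).1 hl).2.1
        simp only [coord, Sum.elim_inl, Sum.elim_inr, hy, if_true] at hc
        omega
      · have hy := ((labelXY y x).1 hl.symm).2.1
        simp only [coord, Sum.elim_inl, Sum.elim_inr, hy, if_true] at hc
        omega
      · rw [labelY] at hl
        have := coordY x y hl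
        rw [hc, sub_self, abs_zero, eq_comm, abs_eq_zero] at this
        exact congrArg _ (Fin.ext (inj' _ _ hl (by omega)))
    · rintro (x | x) (y | y) <;> rw [join_adj hs ht]
      · rw [labelX]
        exact (adj _ _).trans (and_congr_right fun _ => consecutive_iff_abs)
      · exact adjXY x y
      · rw [eq_comm, abs_sub_comm]
        exact adjXY y x
      · rw [labelY]
        refine (adj' _ _).trans (and_congr_right fun h => ?_)
        rw [coordY x y h]
        exact consecutive_iff_abs

theorem exists_join_adj (hs : IsGood n s) (ht : IsGood n t) (hs' : NoFreeSingleton n s)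
    (ht' : NoFreeSingleton n t) (hs0 : s.stack = []) (ht0 : t.stack = [])
    (hst : rankBelow s.marked n = rankBelow t.marked n) (v : Fin n ⊕ Fin n) :
    ∃ w, (join n s t).Adj v w := by
  simp only [join_adj hs ht]
  rcases v with v | v
  · rcases hs' v v.2 (by simp [hs0]) with h | ⟨y, hy⟩
    · have := rankBelow_lt_rankBelow h v.2
      obtain ⟨y, hyn, hy, hvy⟩ := exists_rankBelow_eq (hst ▸ this)
      exact ⟨.inr ⟨y, hyn⟩, h, hy, hvy.symm⟩
    · exact ⟨.inl ⟨y, hs.lt_of_adj _ _ (hs.symm _ _ hy)⟩, hy⟩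
  · rcases ht' v v.2 (by simp [ht0]) with h | ⟨y, hy⟩
    · have := rankBelow_lt_rankBelow h v.2
      obtain ⟨y, hyn, hy, hvy⟩ := exists_rankBelow_eq (hst ▸ this)
      exact ⟨.inl ⟨y, hyn⟩, hy, h, hvy⟩
    · exact ⟨.inr ⟨y, ht.lt_of_adj _ _ (ht.symm _ _ hy)⟩, hy⟩

theorem IsGood.ext {s s' : PartialPaths} (hs : IsGood n s) (hs' : IsGood n s')
    (hstack : s.stack = s'.stack) (hadj : ∀ x y : Fin n, s.adj x y ↔ s'.adj x y)
    (hmark : ∀ x : Fin n, s.marked x ↔ s'.marked x) : s = s' := by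
  ext x y
  · constructor
    · intro h
      exact (hadj ⟨x, hs.lt_of_adj _ _ h⟩ ⟨y, hs.lt_of_adj _ _ (hs.symm _ _ h)⟩).1 h
    · intro h
      exact (hadj ⟨x, hs'.lt_of_adj _ _ h⟩ ⟨y, hs'.lt_of_adj _ _ (hs'.symm _ _ h)⟩).2 h
  · constructor
    · intro h
      exact (hmark ⟨x, hs.lt_of_marked _ h⟩).1 h
    · intro h
      exact (hmark ⟨x, hs'.lt_of_marked _ h⟩).2 h
  · rw [hstack]

/-- Since the numbers of marks agree, every marked point has a partner and its mark is visible in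
the graph. -/
theorem marked_left_iff (hs : IsGood n s) (ht : IsGood n t)
    (hst : rankBelow s.marked n = rankBelow t.marked n) (x : Fin n) :
    s.marked x ↔ ∃ y, (join n s t).Adj (.inl x) (.inr y) := by
  simp only [join_adj hs ht]
  constructor
  · intro h
    have := rankBelow_lt_rankBelow h x.2
    obtain ⟨y, hyn, hy, hvy⟩ := exists_rankBelow_eq (hst ▸ this)
    exact ⟨⟨y, hyn⟩, h, hy, hvy.symm⟩
  · rintro ⟨y, h, -⟩
    exact h

theorem marked_right_iff (hs : IsGood n s) (ht : IsGood n t)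
    (hst : rankBelow s.marked n = rankBelow t.marked n) (x : Fin n) :
    t.marked x ↔ ∃ y, (join n s t).Adj (.inl y) (.inr x) := by
  simp only [join_adj hs ht]
  constructor
  · intro h
    have := rankBelow_lt_rankBelow h x.2
    obtain ⟨y, hyn, hy, hvy⟩ := exists_rankBelow_eq (hst ▸ this)
    exact ⟨⟨y, hyn⟩, hy, h, hvy⟩
  · rintro ⟨y, -, h, -⟩
    exact h

theorem join_injective {s' t' : PartialPaths} (hs : IsGood n s) (ht : IsGood n t)
    (hs' : IsGood n s') (ht' : IsGood n t')
    (hst : rankBelow s.marked n = rankBelow t.marked n)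
    (hst' : rankBelow s'.marked n = rankBelow t'.marked n) (hss : s.stack = s'.stack)
    (htt : t.stack = t'.stack) (h : join n s t = join n s' t') : s = s' ∧ t = t' := by
  constructor
  · refine hs.ext hs' hss (fun x y => ?_) fun x => ?_
    · have e1 := join_adj hs ht (.inl x) (.inl y)
      have e2 := join_adj hs' ht' (.inl x) (.inl y)
      rw [h] at e1
      exact e1.symm.trans e2
    · rw [marked_left_iff hs ht hst, marked_left_iff hs' ht' hst', h]
  · refine ht.ext ht' htt (fun x y => ?_) fun x => ?_
    · have e1 := join_adj hs ht (.inr x) (.inr y)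
      have e2 := join_adj hs' ht' (.inr x) (.inr y)
      rw [h] at e1
      exact e1.symm.trans e2
    · rw [marked_right_iff hs ht hst, marked_right_iff hs' ht' hst', h]

end PartialPaths

/-! ### From one chain to pairs of families, and the final estimate. -/

/-- If `F` is divided into at most `k + 1` classes, then there are at least `|F|² / (k + 1)` pairs
of elements from the same class. -/
theorem Finset.sq_card_le_mul_card_pairs {α : Type*} (F : Finset α) (c : α → ℕ) (k : ℕ)
    (hc : ∀ x ∈ F, c x ≤ k) [DecidablePred fun q : α × α => c q.1 = c q.2] :
    F.card ^ 2 ≤ (k + 1) * ((F ×ˢ F).filter fun q => c q.1 = c q.2).card := by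
  classical
  have h1 : F.card = ∑ j ∈ Finset.range (k + 1), (F.filter fun x => c x = j).card :=
    Finset.card_eq_sum_card_fiberwise fun x hx =>
      Finset.mem_coe.2 (Finset.mem_range.2 (Nat.lt_succ_of_le (hc x (Finset.mem_coe.1 hx))))
  have h2 : ((F ×ˢ F).filter fun q => c q.1 = c q.2).card
      = ∑ j ∈ Finset.range (k + 1), (F.filter fun x => c x = j).card ^ 2 := by
    rw [Finset.card_eq_sum_card_fiberwise (s := (F ×ˢ F).filter fun q => c q.1 = c q.2)
      (f := fun q => c q.1) (t := Finset.range (k + 1))]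
    · refine Finset.sum_congr rfl fun j _ => ?_
      rw [sq, ← Finset.card_product]
      congr 1
      ext ⟨x, y⟩
      simp only [Finset.mem_filter, Finset.mem_product]
      constructor
      · rintro ⟨⟨⟨hx, hy⟩, hxy⟩, hj⟩
        exact ⟨⟨hx, hj⟩, hy, hxy ▸ hj⟩
      · rintro ⟨⟨hx, hj⟩, hy, hj'⟩
        exact ⟨⟨⟨hx, hy⟩, hj.trans hj'.symm⟩, hj⟩
    · intro q hq
      have := Finset.mem_product.1 (Finset.mem_filter.1 (Finset.mem_coe.1 hq)).1
      exact Finset.mem_coe.2 (Finset.mem_range.2 (Nat.lt_succ_of_le (hc _ this.1)))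
  rw [h2, h1]
  have := sq_sum_le_card_mul_sum_sq (s := Finset.range (k + 1))
    (f := fun j => (F.filter fun x => c x = j).card)
  rwa [Finset.card_range] at this

namespace PartialPaths

variable {A : Finset (List ℕ × Bool)}

theorem mem_familiesAt {n h : ℕ} {s : PartialPaths} :
    s ∈ familiesAt A n h ↔ s ∈ families A n ∧ s.stack.length = h := by
  classical
  exact Finset.mem_filter

/-- A lower bound for the number of graphs with a property that all graphs `join n s t` have. -/
theorem sq_card_familiesAt_le (hA : A ⊆ closings) (n : ℕ)
    (P : SimpleGraph (Fin n ⊕ Fin n) → Prop)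
    (hP : ∀ s ∈ familiesAt A n 0, ∀ t ∈ familiesAt A n 0,
      rankBelow s.marked n = rankBelow t.marked n → P (join n s t)) :
    (familiesAt A n 0).card ^ 2 ≤ (n + 1) * {G | P G}.ncard := by
  classical
  refine (Finset.sq_card_le_mul_card_pairs (familiesAt A n 0) (fun s => rankBelow s.marked n) n
    fun s _ => rankBelow_le _ _).trans (Nat.mul_le_mul_left _ ?_)
  have good : ∀ s ∈ familiesAt A n 0, IsGood n s ∧ s.stack = [] := fun s hs =>
    ⟨isGood_of_mem hA n s (mem_familiesAt.1 hs).1,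
      List.length_eq_zero_iff.1 (mem_familiesAt.1 hs).2⟩
  rw [← Set.ncard_coe_finset]
  refine Set.ncard_le_ncard_of_injOn (fun q => join n q.1 q.2) ?_ ?_ (Set.toFinite _)
  · intro q hq
    obtain ⟨hq, hqq⟩ := Finset.mem_filter.1 (Finset.mem_coe.1 hq)
    rw [Finset.mem_product] at hq
    exact hP _ hq.1 _ hq.2 hqq
  · intro q hq q' hq' heq
    obtain ⟨hq, hqq⟩ := Finset.mem_filter.1 (Finset.mem_coe.1 hq)
    obtain ⟨hq', hqq'⟩ := Finset.mem_filter.1 (Finset.mem_coe.1 hq')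
    rw [Finset.mem_product] at hq hq'
    obtain ⟨h1, h2⟩ := join_injective (good _ hq.1).1 (good _ hq.2).1 (good _ hq'.1).1
      (good _ hq'.2).1 hqq hqq' ((good _ hq.1).2.trans (good _ hq'.1).2.symm)
      ((good _ hq.2).2.trans (good _ hq'.2).2.symm) heq
    exact Prod.ext h1 h2

end PartialPaths

/-- An exponential bound with a polynomial loss implies one with a smaller base. -/
theorem exists_const_mul_pow_le {μ ν K : ℝ} (hμ : 0 < μ) (hμν : μ < ν) (hν : ν ≤ 3 / 2 * μ)
    (hK : 0 < K) (k : ℕ) : ∃ c : ℝ, 0 < c ∧ ∀ (n N F : ℕ), F ^ 2 ≤ (n + k + 1) * N →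
      ν ^ n ≤ K * F → c * μ ^ (2 * (n + k)) ≤ N := by
  set ε : ℝ := ν / μ - 1 with hε
  have hε0 : 0 < ε := by rw [hε, sub_pos, lt_div_iff₀ hμ]; linarith
  have hε1 : 2 * ε ≤ 1 := by
    have : ν / μ ≤ 3 / 2 := by rwa [div_le_iff₀ hμ]
    rw [hε]
    linarith
  -- The factor `k + 1` comes from n + k + 1 ≤ (k + 1)(n + 1), and `μ ^ (2 * k)` from the shift of
  -- the exponent by `k`.
  refine ⟨2 * ε / ((k + 1) * K ^ 2 * μ ^ (2 * k)), by positivity, fun n N F hF hνF => ?_⟩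
  have hF' : (F : ℝ) ^ 2 ≤ (n + k + 1) * N := by exact_mod_cast hF
  have hν0 : 0 < ν := hμ.trans hμν
  have h1 : (ν ^ n) ^ 2 ≤ K ^ 2 * ((n + k + 1) * N) := by
    calc (ν ^ n) ^ 2 ≤ (K * F) ^ 2 := by gcongr
      _ = K ^ 2 * (F : ℝ) ^ 2 := by ring
      _ ≤ _ := by gcongr
  -- Bernoulli's inequality gives 1 + 2nε, and 2ε ≤ 1 makes this at least 2ε(n + 1). This linear
  -- growth pays for the number of classes.
  have h2 : 2 * ε * (n + 1) ≤ (ν / μ) ^ (2 * n) := by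
    have := one_add_mul_le_pow (a := ε) (by linarith) (2 * n)
    rw [show 1 + ε = ν / μ by rw [hε]; ring] at this
    push_cast at this
    nlinarith
  have h3 : 2 * ε * (n + 1) * μ ^ (2 * n) ≤ (ν ^ n) ^ 2 := by
    rw [div_pow, le_div_iff₀ (by positivity)] at h2
    rwa [← pow_mul, mul_comm n 2]
  have h4 : (n + k + 1 : ℝ) ≤ (k + 1) * (n + 1) := by
    have : (0 : ℝ) ≤ (k : ℝ) * n := by positivity
    linarith
  have h5 : 2 * ε * μ ^ (2 * n) * (n + 1) ≤ (K ^ 2 * (k + 1) * N) * (n + 1) := by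
    calc 2 * ε * μ ^ (2 * n) * (n + 1) = 2 * ε * (n + 1) * μ ^ (2 * n) := by ring
      _ ≤ K ^ 2 * ((n + k + 1) * N) := h3.trans h1
      _ ≤ K ^ 2 * (((k + 1) * (n + 1)) * N) := by gcongr
      _ = _ := by ring
  have h6 := le_of_mul_le_mul_right h5 (by positivity)
  rw [div_mul_eq_mul_div, div_le_iff₀ (by positivity)]
  calc 2 * ε * μ ^ (2 * (n + k)) = 2 * ε * μ ^ (2 * n) * μ ^ (2 * k) := by
        rw [mul_add, pow_add]
        ring
    _ ≤ K ^ 2 * (k + 1) * N * μ ^ (2 * k) := by gcongr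
    _ = _ := by ring

open PartialPaths in
theorem theorem5 :
    (∃ c : ℝ, 0 < c ∧ ∃ n₀ : ℕ, ∀ n : ℕ, n₀ ≤ n → ∀ D : Finset (ℝ × ℝ), IsDoubleChain n D →
      c * (7.164102920 : ℝ) ^ (2 * n) ≤ (numNCP D : ℝ)) ∧
    (∃ c : ℝ, 0 < c ∧ ∃ n₀ : ℕ, ∀ n : ℕ, n₀ ≤ n → ∀ D : Finset (ℝ × ℝ), IsDoubleChain n D →
      c * (6.164492582 : ℝ) ^ (2 * n) ≤ (numNCPWS D : ℝ)) := by
  have cast : ∀ p n F : ℕ, p ^ n ≤ 5 ^ n * (619272 * F) → ((p : ℝ) / 5) ^ n ≤ 619272 * F := by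
    intro p n F h
    rw [div_pow, div_le_iff₀ (by positivity), mul_comm]
    exact_mod_cast h
  constructor
  -- The 9 counts the extra points that empty the stack; it is also the threshold for `n`.
  · obtain ⟨c, hc, h⟩ := exists_const_mul_pow_le (μ := 7.164102920) (ν := (36 : ℕ) / 5)
      (K := 619272) (by norm_num) (by norm_num) (by norm_num) (by norm_num) 9
    refine ⟨c, hc, 9, fun n hn D hD => ?_⟩
    obtain ⟨n, rfl⟩ := Nat.exists_eq_add_of_le' hn
    refine h n _ _ ?_ (cast _ _ _ (pow_le_card_closings n))
    refine le_trans ?_ (Nat.mul_le_mul_left _ (hD.ncard_le_numNCP (by omega)))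
    refine sq_card_familiesAt_le subset_rfl (n + 9) _ fun s hs t ht _ => ?_
    exact isOrderNCP_join (isGood_of_mem subset_rfl _ s (mem_familiesAt.1 hs).1)
      (isGood_of_mem subset_rfl _ t (mem_familiesAt.1 ht).1)
  · obtain ⟨c, hc, h⟩ := exists_const_mul_pow_le (μ := 6.164492582) (ν := (31 : ℕ) / 5)
      (K := 619272) (by norm_num) (by norm_num) (by norm_num) (by norm_num) 9
    refine ⟨c, hc, 9, fun n hn D hD => ?_⟩
    obtain ⟨n, rfl⟩ := Nat.exists_eq_add_of_le' hn
    refine h n _ _ ?_ (cast _ _ _ (pow_le_card_closingsWS n))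
    refine le_trans ?_ (Nat.mul_le_mul_left _ (hD.ncard_le_numNCPWS (by omega)))
    have hA : closingsWS ⊆ closings := Finset.erase_subset _ _
    have hA' : ([0], false) ∉ closingsWS := Finset.notMem_erase _ _
    refine sq_card_familiesAt_le hA (n + 9) _ fun s hs t ht hst => ?_
    have hs' := mem_familiesAt.1 hs
    have ht' := mem_familiesAt.1 ht
    have gs := isGood_of_mem hA _ s hs'.1
    have gt := isGood_of_mem hA _ t ht'.1
    exact ⟨isOrderNCP_join gs gt, exists_join_adj gs gt (noFreeSingleton_of_mem hA hA' _ s hs'.1)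
      (noFreeSingleton_of_mem hA hA' _ t ht'.1) (List.length_eq_zero_iff.1 hs'.2)
      (List.length_eq_zero_iff.1 ht'.2) hst⟩
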